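/- Let $M$ be a smooth manifold of dimension $m$, $D\subset TM$ a smooth distribution of rank $m-1$ whose Levi map $\mathcal L_x: D_x\times D_x\to T_xM/D_x$, $(X_x,Y_x)\mapsto [X,Y]_x \bmod D_x$, is non-zero for every $x\in M$, and $g$ a smooth positive definite metric on $D$. Write $\mathrm{gr}(T_xM)=D_x\oplus T_xM/D_x$ for the graded nilpotent Lie algebra whose only non-trivial bracket is $\mathcal L_x$. Let $\mathrm{GL}^{\mathrm{gr}}(D)\rightrightarrows M$ be the Lie groupoid of all isomorphisms of graded vector spaces $\gamma=(\gamma^{-1},\gamma^{-2}):\mathrm{gr}(T_xM)\to\mathrm{gr}(T_yM)$, $x,y\in M$, where $\gamma^{-1}:D_x\to D_y$ and $\gamma^{-2}:T_xM/D_x\to T_yM/D_y$; its topology is the one in which smooth local frames of $\mathrm{gr}(TM)$ over open sets $U,V\subseteq M$ identify the arrows from points of $U$ to points of $V$ with $U\times V\times \mathrm{GL}(m-1,\mathbb R)\times\mathbb R^{\times}$. Let $\mathcal G\subseteq \mathrm{GL}^{\mathrm{gr}}(D)$ be the subgroupoid, with the induced topology, of those $\gamma$ that are Lie algebra isomorphisms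 and for which $\gamma^{-1}:(D_x,g_x)\to(D_y,g_y)$ is an isometry; $s$ and $t$ denote source and target. Put $n=\lfloor (m-1)/2\rfloor$. For $x\in M$ let $\theta_x$ be a non-zero linear functional on $T_xM/D_x$, let $J_x$ be the $g_x$-skew endomorphism of $D_x$ with $g_x(J_xv,w)=-\theta_x(\mathcal L_x(v,w))$, and let $0\le\alpha_1^x\le\dots\le\alpha_n^x$ be the numbers such that the eigenvalues of $J_x$, with multiplicity, are $\pm i\alpha_1^x,\dots,\pm i\alpha_n^x$ (and one more $0$ if $m-1$ is odd). The type map is $\alpha:M\to\mathbb{RP}^{n-1}$, $\alpha(x)=[\alpha_1^x:\dots:\alpha_n^x]$; it does not depend on the choice of $\theta_x$. Then the groupoid $\mathcal G$ is proper, that is, the map $(s,t):\mathcal G\to M\times M$ is proper. Moreover the isotropy groups $\mathcal G_x=\{\gamma\in\mathcal G : s(\gamma)=t(\gamma)=x\}$ are compact, and the image of $(s,t)$ is $M\times_\alpha M=\{(x,y) : \alpha(x)=\alpha(y)\}$, which is closed in $M\times M$. (In particular this holds when $\alpha(M)$ is a submanifold of a single stratum of the simplex $\Delta^{n-1}\subset\mathbb{RP}^{n-1}$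 and $\alpha$ is a submersion onto $\alpha(M)$, in which case $\mathcal G$ is a regular Lie subgroupoid of $\mathrm{GL}^{\mathrm{gr}}(D)$ and carries the induced topology.) -/

import Mathlib

open scoped Manifold ContDiff Bundle Topology

set_option linter.unusedSectionVars false

noncomputable section

namespace SubRiemannian

/-- A (possibly rough) section `X` of a family `D` of subspaces of the tangent spaces of `M` is
smooth on `U`, as a vector field on `M`. -/
def SmoothSectionOn {E : Type*} [NormedAddCommGroup E] [NormedSpace ℝ E]
    {M : Type*} [TopologicalSpace M] [ChartedSpace E M]
    [IsManifold 𝓘(ℝ, E) ∞ M] (D : ∀ x : M, Submodule ℝ (TangentSpace 𝓘(ℝ, E) x)) (X : ∀ x : M, D x) (U : Set M) : Prop :=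
  ContMDiffOn 𝓘(ℝ, E) 𝓘(ℝ, E).tangent ∞
    (fun x : M => (⟨x, (X x : TangentSpace 𝓘(ℝ, E) x)⟩ : TangentBundle 𝓘(ℝ, E) M)) U

/-- The Lie bracket at `x` of two sections of `D`. -/
def bracketAt {E : Type*} [NormedAddCommGroup E] [NormedSpace ℝ E]
    {M : Type*} [TopologicalSpace M] [ChartedSpace E M]
    [IsManifold 𝓘(ℝ, E) ∞ M] (D : ∀ x : M, Submodule ℝ (TangentSpace 𝓘(ℝ, E) x)) (X Y : ∀ x : M, D x) (x : M) :
    TangentSpace 𝓘(ℝ, E) x :=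
  VectorField.mlieBracket 𝓘(ℝ, E) (fun y : M => (X y : TangentSpace 𝓘(ℝ, E) y))
    (fun y : M => (Y y : TangentSpace 𝓘(ℝ, E) y)) x

/-- A smooth distribution of corank one on `M`: a family of hyperplanes in the tangent spaces
with smooth local frames. -/
structure CorankOneDistribution (E : Type*) [NormedAddCommGroup E] [NormedSpace ℝ E]
    (M : Type*) [TopologicalSpace M] [ChartedSpace E M] [IsManifold 𝓘(ℝ, E) ∞ M] where
  /-- the hyperplane `D_x` of `T_x M` -/
  fiber : ∀ x : M, Submodule ℝ (TangentSpace 𝓘(ℝ, E) x)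
  corank_one : ∀ x : M, Module.finrank ℝ (fiber x) + 1 = Module.finrank ℝ E
  exists_frame : ∀ x₀ : M, ∃ U : Set M, IsOpen U ∧ x₀ ∈ U ∧
    ∃ e : Fin (Module.finrank ℝ E - 1) → ∀ x : M, fiber x,
      (∀ i, SmoothSectionOn fiber (e i) U) ∧
      ∀ x ∈ U, LinearIndependent ℝ (fun i => e i x)

/-- A corank-one sub-Riemannian structure `(D, g)` on `M`: a smooth distribution `D` of corank
one whose Levi map `(X, Y) ↦ [X, Y] mod D` vanishes at no point of `M` (equivalently, `D` is
bracket-generating of step two), and a smooth positive definite metric `g` on `D`. -/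
structure CorankOneSubRiemannian (E : Type*) [NormedAddCommGroup E] [NormedSpace ℝ E]
    (M : Type*) [TopologicalSpace M] [ChartedSpace E M] [IsManifold 𝓘(ℝ, E) ∞ M]
    extends CorankOneDistribution E M where
  nonintegrable : ∀ x : M, ∃ U : Set M, IsOpen U ∧ x ∈ U ∧ ∃ X Y : ∀ y : M, fiber y,
    SmoothSectionOn fiber X U ∧ SmoothSectionOn fiber Y U ∧ bracketAt fiber X Y x ∉ fiber x
  /-- the inner product `g_x` on `D_x` -/
  metric : ∀ x : M, LinearMap.BilinForm ℝ (fiber x)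
  metric_symm : ∀ (x : M) (v w : fiber x), metric x v w = metric x w v
  metric_pos : ∀ (x : M) (v : fiber x), v ≠ 0 → 0 < metric x v v
  metric_smooth : ∀ (U : Set M), IsOpen U → ∀ X Y : ∀ y : M, fiber y,
    SmoothSectionOn fiber X U → SmoothSectionOn fiber Y U →
    ContMDiffOn 𝓘(ℝ, E) 𝓘(ℝ, ℝ) ∞ (fun x => metric x (X x) (Y x)) U

section Levi

variable {E : Type*} [NormedAddCommGroup E] [NormedSpace ℝ E] [FiniteDimensional ℝ E]
  {M : Type*} [TopologicalSpace M] [ChartedSpace E M] [IsManifold 𝓘(ℝ, E) ∞ M]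

/-- Coefficients of a differentiable vector field with respect to differentiable, linearly
independent vector fields spanning it are differentiable. -/
lemma exists_coeff {r : ℕ} {x : M} (e : Fin r → ∀ y : M, TangentSpace 𝓘(ℝ, E) y)
    (he : ∀ i, MDifferentiableAt 𝓘(ℝ, E) 𝓘(ℝ, E).tangent
      (fun y : M => (⟨y, e i y⟩ : TangentBundle 𝓘(ℝ, E) M)) x)
    (hli : LinearIndependent ℝ (fun i => e i x)) (X : ∀ y : M, TangentSpace 𝓘(ℝ, E) y)
    (hX : MDifferentiableAt 𝓘(ℝ, E) 𝓘(ℝ, E).tangent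
      (fun y : M => (⟨y, X y⟩ : TangentBundle 𝓘(ℝ, E) M)) x)
    (hspan : ∀ᶠ y in 𝓝 x, X y ∈ Submodule.span ℝ (Set.range fun i => e i y)) :
    ∃ c : Fin r → M → ℝ, (∀ i, MDifferentiableAt 𝓘(ℝ, E) 𝓘(ℝ, ℝ) (c i) x) ∧
      ∀ᶠ y in 𝓝 x, X y = ∑ i, c i y • e i y := by
  set t := trivializationAt E (TangentSpace 𝓘(ℝ, E) : M → Type _) x with ht
  have hxt : x ∈ t.baseSet := FiberBundle.mem_baseSet_trivializationAt' x
  have he' : ∀ i, MDifferentiableAt 𝓘(ℝ, E) 𝓘(ℝ, E) (fun y => (t ⟨y, e i y⟩).2) x := fun i =>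
    (mdifferentiableAt_section 𝓘(ℝ, E) (fun y => e i y)).1 (he i)
  have hX' : MDifferentiableAt 𝓘(ℝ, E) 𝓘(ℝ, E) (fun y => (t ⟨y, X y⟩).2) x :=
    (mdifferentiableAt_section 𝓘(ℝ, E) (fun y => X y)).1 hX
  have hlin : ∀ (y : M) (hy : y ∈ t.baseSet) (v : TangentSpace 𝓘(ℝ, E) y),
      (t ⟨y, v⟩).2 = t.continuousLinearEquivAt ℝ y hy v := fun _ _ _ => rfl
  have hli' : LinearIndependent ℝ (fun i => (t ⟨x, e i x⟩).2) := by
    have := hli.map' (t.continuousLinearEquivAt ℝ x hxt).toLinearEquiv.toLinearMap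
      (LinearEquiv.ker _)
    exact this
  obtain ⟨L, hL⟩ := LinearMap.exists_leftInverse_of_injective
    (Fintype.linearCombination ℝ (fun i => (t ⟨x, e i x⟩).2))
    (LinearMap.ker_eq_bot.2 hli'.fintypeLinearCombination_injective)
  let Lc : E →L[ℝ] (Fin r → ℝ) := L.toContinuousLinearMap
  let A : M → ((Fin r → ℝ) →L[ℝ] (Fin r → ℝ)) := fun y =>
    ∑ j, (ContinuousLinearMap.proj (R := ℝ) (φ := fun _ : Fin r => ℝ) j).smulRight
      (Lc (t ⟨y, e j y⟩).2)
  have hAx : A x = 1 := by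
    ext1 v
    have h1 := LinearMap.congr_fun hL v
    simp only [LinearMap.comp_apply, Fintype.linearCombination_apply, map_sum, map_smul,
      LinearMap.id_apply] at h1
    simpa [A, Lc] using h1
  have hA : MDifferentiableAt 𝓘(ℝ, E) 𝓘(ℝ, (Fin r → ℝ) →L[ℝ] (Fin r → ℝ)) A x := by
    let Φ : (Fin r → E) → ((Fin r → ℝ) →L[ℝ] (Fin r → ℝ)) := fun w =>
      ∑ j, (ContinuousLinearMap.proj (R := ℝ) (φ := fun _ : Fin r => ℝ) j).smulRight (Lc (w j))
    have hΦ : Differentiable ℝ Φ := by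
      unfold Φ
      refine Differentiable.fun_sum fun j _ => ?_
      have h2 : Differentiable ℝ (fun w : Fin r → E => Lc (w j)) := by fun_prop
      exact ((ContinuousLinearMap.smulRightL ℝ (Fin r → ℝ) (Fin r → ℝ)
        (ContinuousLinearMap.proj (R := ℝ) (φ := fun _ : Fin r => ℝ) j)).differentiable.comp h2)
    have h3 : MDifferentiableAt 𝓘(ℝ, E) 𝓘(ℝ, Fin r → E) (fun y j => (t ⟨y, e j y⟩).2) x :=
      by
      have h7 : MDifferentiableAt 𝓘(ℝ, E) 𝓘(ℝ, Fin r → E)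
          (∑ j, fun y => ContinuousLinearMap.single ℝ (fun _ : Fin r => E) j (t ⟨y, e j y⟩).2) x :=
        MDifferentiableAt.sum fun j _ =>
          ((ContinuousLinearMap.single ℝ (fun _ : Fin r => E) j).differentiableAt
            ).comp_mdifferentiableAt (f := fun y => (t ⟨y, e j y⟩).2) (he' j)
      convert h7 using 1
      ext y j
      simp
    exact (hΦ _).comp_mdifferentiableAt (f := fun y j => (t ⟨y, e j y⟩).2) h3
  have hinv : MDifferentiableAt 𝓘(ℝ, E) 𝓘(ℝ, (Fin r → ℝ) →L[ℝ] (Fin r → ℝ))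
      (Ring.inverse ∘ A) x := by
    refine DifferentiableAt.comp_mdifferentiableAt ?_ hA
    exact differentiableAt_inverse (by rw [hAx]; exact isUnit_one)
  have hLX : MDifferentiableAt 𝓘(ℝ, E) 𝓘(ℝ, Fin r → ℝ) (fun y => Lc (t ⟨y, X y⟩).2) x :=
    (Lc.differentiableAt).comp_mdifferentiableAt (f := fun y => (t ⟨y, X y⟩).2) hX'
  have hunit : ∀ᶠ y in 𝓝 x, IsUnit (A y) :=
    hA.continuousAt.eventually (by rw [hAx]; exact Units.isOpen.mem_nhds isUnit_one)
  refine ⟨fun i y => Ring.inverse (A y) (Lc (t ⟨y, X y⟩).2) i, fun i => ?_, ?_⟩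
  · have h4 := hinv.clm_apply hLX
    exact ((ContinuousLinearMap.proj (R := ℝ) (φ := fun _ : Fin r => ℝ) i).differentiableAt
      ).comp_mdifferentiableAt (f := fun y => (Ring.inverse ∘ A) y (Lc (t ⟨y, X y⟩).2)) h4
  · filter_upwards [hspan, hunit, t.open_baseSet.mem_nhds hxt] with y hy hu hyt
    obtain ⟨a, ha⟩ := (Submodule.mem_span_range_iff_exists_fun ℝ).1 hy
    have h5 : Lc (t ⟨y, X y⟩).2 = A y a := by
      rw [hlin y hyt, ← ha, map_sum, map_sum]
      simp only [A, hlin y hyt, map_smul, sum_apply,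
        ContinuousLinearMap.smulRight_apply, ContinuousLinearMap.proj_apply]
    have h6 : Ring.inverse (A y) (Lc (t ⟨y, X y⟩).2) = a := by
      rw [h5]
      have := Ring.inverse_mul_cancel _ hu
      exact congrArg (fun f : (Fin r → ℝ) →L[ℝ] (Fin r → ℝ) => f a) this
    rw [h6, ha]

/-- Lie brackets of combinations of sections of `P`, modulo `P`. -/
lemma sum_bracket {ι : Type*} {x : M} (e : ι → ∀ y : M, TangentSpace 𝓘(ℝ, E) y)
    (he : ∀ i, MDifferentiableAt 𝓘(ℝ, E) 𝓘(ℝ, E).tangent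
      (fun y : M => (⟨y, e i y⟩ : TangentBundle 𝓘(ℝ, E) M)) x)
    (c : ι → M → ℝ) (hc : ∀ i, MDifferentiableAt 𝓘(ℝ, E) 𝓘(ℝ, ℝ) (c i) x)
    (W : ∀ y : M, TangentSpace 𝓘(ℝ, E) y) (P : Submodule ℝ (TangentSpace 𝓘(ℝ, E) x))
    (hP : ∀ i, e i x ∈ P) (s : Finset ι) :
    P.mkQ (VectorField.mlieBracket 𝓘(ℝ, E) (fun y => ∑ i ∈ s, c i y • e i y) W x) =
      ∑ i ∈ s, c i x • P.mkQ (VectorField.mlieBracket 𝓘(ℝ, E) (e i) W x) := by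
  classical
  have : IsManifold 𝓘(ℝ, E) 2 M := inferInstance
  have : CompleteSpace E := FiniteDimensional.complete ℝ E
  induction s using Finset.induction_on with
  | empty =>
    have h0 : (fun y : M => ∑ i ∈ (∅ : Finset ι), c i y • e i y) = 0 := by
      ext y
      simp
    rw [h0]
    simp
  | insert a s ha ih =>
    have h1 : (fun y : M => ∑ i ∈ insert a s, c i y • e i y) =
        (c a • e a) + fun y => ∑ i ∈ s, c i y • e i y := by
      funext y
      rw [Finset.sum_insert ha]
      rfl
    rw [h1, VectorField.mlieBracket_add_left ((hc a).smul_section (he a))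
      (MDifferentiableAt.sum_section (t := fun i y => c i y • e i y)
        fun i _ => (hc i).smul_section (he i)),
      VectorField.mlieBracket_smul_left (hc a) (he a), Finset.sum_insert ha, ← ih]
    simp only [map_add, map_smul, add_left_inj]
    have h2 : P.mkQ (e a x) = 0 := by simpa using hP a
    rw [h2]
    simp

namespace CorankOneDistribution

/-- The line `T_x M / D_x`. -/
abbrev Quot (D : CorankOneDistribution E M) (x : M) : Type _ :=
  TangentSpace 𝓘(ℝ, E) x ⧸ D.fiber x

instance (D : CorankOneDistribution E M) (x : M) : FiniteDimensional ℝ (D.fiber x) :=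
  by
  have : FiniteDimensional ℝ (TangentSpace 𝓘(ℝ, E) x) := inferInstanceAs (FiniteDimensional ℝ E)
  infer_instance

lemma finrank_fiber (D : CorankOneDistribution E M) (x : M) :
    Module.finrank ℝ (D.fiber x) = Module.finrank ℝ E - 1 := by
  have := D.corank_one x
  omega

/-- Independent smooth sections of `D`, in the right number, give bases of the fibres. -/
def basisOf (D : CorankOneDistribution E M) (x : M)
    (e : Fin (Module.finrank ℝ E - 1) → D.fiber x) (he : LinearIndependent ℝ e) :
    Module.Basis (Fin (Module.finrank ℝ E - 1)) ℝ (D.fiber x) :=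
  Module.Basis.mk he
    (he.span_eq_top_of_card_eq_finrank' (by rw [Fintype.card_fin, D.finrank_fiber])).ge

/-- A smooth frame of `D` around `x`. -/
def frame (D : CorankOneDistribution E M) (x : M) :
    Fin (Module.finrank ℝ E - 1) → ∀ y : M, D.fiber y :=
  (D.exists_frame x).choose_spec.2.2.choose

lemma frame_spec (D : CorankOneDistribution E M) (x : M) :
    ∃ U : Set M, IsOpen U ∧ x ∈ U ∧ (∀ i, SmoothSectionOn D.fiber (D.frame x i) U) ∧
      ∀ y ∈ U, LinearIndependent ℝ (fun i => D.frame x i y) :=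
  ⟨(D.exists_frame x).choose, (D.exists_frame x).choose_spec.1, (D.exists_frame x).choose_spec.2.1,
    (D.exists_frame x).choose_spec.2.2.choose_spec⟩

lemma frame_linearIndependent (D : CorankOneDistribution E M) (x : M) :
    LinearIndependent ℝ (fun i => D.frame x i x) := by
  obtain ⟨U, -, hx, -, h⟩ := D.frame_spec x
  exact h x hx

lemma frame_mdifferentiableAt (D : CorankOneDistribution E M) (x : M)
    (i : Fin (Module.finrank ℝ E - 1)) :
    MDifferentiableAt 𝓘(ℝ, E) 𝓘(ℝ, E).tangent (fun y : M =>
      (⟨y, (D.frame x i y : TangentSpace 𝓘(ℝ, E) y)⟩ : TangentBundle 𝓘(ℝ, E) M)) x := by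
  obtain ⟨U, hU, hx, h, -⟩ := D.frame_spec x
  exact ((h i).contMDiffAt (hU.mem_nhds hx)).mdifferentiableAt (by simp)

/-- The Levi map `D_x × D_x → T_x M / D_x`, `(X_x, Y_x) ↦ [X, Y]_x mod D_x`, computed on a frame.
See `levi_apply` for its value on arbitrary sections, in particular its independence of choices. -/
def levi (D : CorankOneDistribution E M) (x : M) :
    D.fiber x →ₗ[ℝ] D.fiber x →ₗ[ℝ] D.Quot x :=
  (D.basisOf x _ (D.frame_linearIndependent x)).constr ℝ fun i =>
    (D.basisOf x _ (D.frame_linearIndependent x)).constr ℝ fun j =>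
      (D.fiber x).mkQ (bracketAt D.fiber (D.frame x i) (D.frame x j) x)

/-- A section of `D` with prescribed value at `x`, smooth near `x`. -/
lemma exists_section (D : CorankOneDistribution E M) (x : M) (v : D.fiber x) :
    ∃ X : ∀ y : M, D.fiber y, X x = v ∧ MDifferentiableAt 𝓘(ℝ, E) 𝓘(ℝ, E).tangent
      (fun y : M => (⟨y, (X y : TangentSpace 𝓘(ℝ, E) y)⟩ : TangentBundle 𝓘(ℝ, E) M)) x := by
  let b := D.basisOf x _ (D.frame_linearIndependent x)
  refine ⟨fun y => ∑ i, b.repr v i • D.frame x i y, ?_, ?_⟩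
  · conv_rhs => rw [← b.sum_repr v]
    simp [b, basisOf]
  · have h : MDifferentiableAt 𝓘(ℝ, E) 𝓘(ℝ, E).tangent (fun y : M =>
        (⟨y, ∑ i, b.repr v i • (D.frame x i y : TangentSpace 𝓘(ℝ, E) y)⟩ :
          TangentBundle 𝓘(ℝ, E) M)) x :=
      MDifferentiableAt.sum_section (t := fun i y => b.repr v i •
        (D.frame x i y : TangentSpace 𝓘(ℝ, E) y))
        fun i _ => mdifferentiableAt_const.smul_section (D.frame_mdifferentiableAt x i)
    simpa using h

/-- The Levi map is computed by any sections of `D` through the given vectors. -/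
lemma levi_apply (D : CorankOneDistribution E M) (x : M) (X Y : ∀ y : M, D.fiber y)
    (hX : MDifferentiableAt 𝓘(ℝ, E) 𝓘(ℝ, E).tangent
      (fun y : M => (⟨y, (X y : TangentSpace 𝓘(ℝ, E) y)⟩ : TangentBundle 𝓘(ℝ, E) M)) x)
    (hY : MDifferentiableAt 𝓘(ℝ, E) 𝓘(ℝ, E).tangent
      (fun y : M => (⟨y, (Y y : TangentSpace 𝓘(ℝ, E) y)⟩ : TangentBundle 𝓘(ℝ, E) M)) x) :
    D.levi x (X x) (Y x) = (D.fiber x).mkQ (bracketAt D.fiber X Y x) := by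
  have key : ∀ X : ∀ y : M, D.fiber y, MDifferentiableAt 𝓘(ℝ, E) 𝓘(ℝ, E).tangent
      (fun y : M => (⟨y, (X y : TangentSpace 𝓘(ℝ, E) y)⟩ : TangentBundle 𝓘(ℝ, E) M)) x →
      ∃ c : Fin (Module.finrank ℝ E - 1) → ℝ, X x = ∑ i, c i • D.frame x i x ∧
      ∀ W : ∀ y : M, D.fiber y, (D.fiber x).mkQ (bracketAt D.fiber X W x) =
        ∑ i, c i • (D.fiber x).mkQ (bracketAt D.fiber (D.frame x i) W x) := by
    intro X hX
    obtain ⟨U, hU, hxU, -, hli⟩ := D.frame_spec x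
    obtain ⟨c, hc, hXc⟩ := exists_coeff
      (fun i y => (D.frame x i y : TangentSpace 𝓘(ℝ, E) y)) (D.frame_mdifferentiableAt x)
      ((D.frame_linearIndependent x).map' (D.fiber x).subtype (Submodule.ker_subtype _))
      (fun y => (X y : TangentSpace 𝓘(ℝ, E) y)) hX (by
        filter_upwards [hU.mem_nhds hxU] with y hy
        have h1 := (D.basisOf y _ (hli y hy)).sum_repr (X y)
        rw [← h1]
        simp only [basisOf, Module.Basis.coe_mk, Submodule.coe_sum, Submodule.coe_smul]
        exact Submodule.sum_mem _ fun i _ =>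
          Submodule.smul_mem _ _ (Submodule.subset_span ⟨i, rfl⟩))
    refine ⟨fun i => c i x, ?_, fun W => ?_⟩
    · ext
      simpa using hXc.self_of_nhds
    · unfold bracketAt
      have h2 := sum_bracket (fun i y => (D.frame x i y : TangentSpace 𝓘(ℝ, E) y))
        (D.frame_mdifferentiableAt x) c hc (fun y => (W y : TangentSpace 𝓘(ℝ, E) y)) (D.fiber x)
        (fun i => (D.frame x i x).2) Finset.univ
      rw [← h2]
      congr 1
      exact Filter.EventuallyEq.mlieBracket_vectorField_eq hXc Filter.EventuallyEq.rfl
  have swap : ∀ X W : ∀ y : M, D.fiber y, bracketAt D.fiber X W x = - bracketAt D.fiber W X x :=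
    fun X W => VectorField.mlieBracket_swap_apply
  obtain ⟨a, hXa, ha⟩ := key X hX
  obtain ⟨b, hYb, hb⟩ := key Y hY
  have hbas : ∀ i, D.frame x i x = D.basisOf x _ (D.frame_linearIndependent x) i := by
    intro i
    simp [basisOf]
  have hY' : ∀ i, (D.fiber x).mkQ (bracketAt D.fiber (D.frame x i) Y x) =
      ∑ j, b j • D.levi x (D.frame x i x) (D.frame x j x) := by
    intro i
    rw [swap, map_neg, hb, ← Finset.sum_neg_distrib]
    refine Finset.sum_congr rfl fun j _ => ?_
    rw [← smul_neg, ← map_neg, ← swap, hbas i, hbas j]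
    simp only [levi, Module.Basis.constr_basis]
  rw [ha, hXa, hYb]
  simp only [hY', map_sum, map_smul, LinearMap.sum_apply, LinearMap.smul_apply, Finset.smul_sum]
  rw [Finset.sum_comm]
  exact Finset.sum_congr rfl fun i _ => Finset.sum_congr rfl fun j _ => smul_comm _ _ _

lemma levi_self (D : CorankOneDistribution E M) (x : M) (v : D.fiber x) :
    D.levi x v v = 0 := by
  obtain ⟨X, rfl, hX⟩ := D.exists_section x v
  rw [D.levi_apply x X X hX hX]
  simp [bracketAt]

lemma levi_swap (D : CorankOneDistribution E M) (x : M) (v w : D.fiber x) :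
    D.levi x v w = - D.levi x w v := by
  have h := D.levi_self x (v + w)
  simp only [map_add, LinearMap.add_apply, levi_self, zero_add, add_zero] at h
  exact eq_neg_of_add_eq_zero_right h

/-- The graded tangent space `gr(T_x M) = D_x ⊕ T_x M / D_x`. -/
def Gr (D : CorankOneDistribution E M) (x : M) : Type _ := D.fiber x × D.Quot x

instance (D : CorankOneDistribution E M) (x : M) : AddCommGroup (D.Gr x) :=
  inferInstanceAs (AddCommGroup (D.fiber x × D.Quot x))

instance (D : CorankOneDistribution E M) (x : M) : Module ℝ (D.Gr x) :=
  inferInstanceAs (Module ℝ (D.fiber x × D.Quot x))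

/-- The osculating Lie algebra: the only non-trivial bracket on `gr(T_x M)` is the Levi map. -/
instance (D : CorankOneDistribution E M) (x : M) : LieRing (D.Gr x) where
  bracket a b := ((0 : D.fiber x), D.levi x a.1 b.1)
  add_lie a b c := by
    refine Prod.ext (zero_add (0 : D.fiber x)).symm ?_
    exact (congrArg (fun f => f c.1) (map_add (D.levi x) a.1 b.1))
  lie_add a b c := by
    refine Prod.ext (zero_add (0 : D.fiber x)).symm ?_
    exact map_add (D.levi x a.1) b.1 c.1
  lie_self a := Prod.ext rfl (D.levi_self x a.1)
  leibniz_lie a b c := by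
    refine Prod.ext (zero_add (0 : D.fiber x)).symm ?_
    change D.levi x a.1 0 = D.levi x 0 c.1 + D.levi x b.1 0
    simp

instance (D : CorankOneDistribution E M) (x : M) : LieAlgebra ℝ (D.Gr x) where
  lie_smul c a b := by
    refine Prod.ext (smul_zero c).symm ?_
    exact map_smul (D.levi x a.1) c b.1

/-- An arrow `x → y` of the groupoid `GL^gr(D)`: an isomorphism of graded vector spaces
`gr(T_x M) → gr(T_y M)`, given by its components in degrees `-1` and `-2`. -/
@[ext]
structure GradedIso (D : CorankOneDistribution E M) (x y : M) where
  /-- the component `D_x → D_y` -/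
  deg1 : D.fiber x ≃ₗ[ℝ] D.fiber y
  /-- the component `T_x M / D_x → T_y M / D_y` -/
  deg2 : D.Quot x ≃ₗ[ℝ] D.Quot y

/-- The map `gr(T_x M) → gr(T_y M)` with the given components. -/
def GradedIso.map {D : CorankOneDistribution E M} {x y : M} (γ : D.GradedIso x y)
    (a : D.Gr x) : D.Gr y :=
  (γ.deg1 a.1, γ.deg2 a.2)

/-- The objects of the groupoid `GL^gr(D)`: the points of `M`. -/
def Base (_D : CorankOneDistribution E M) : Type _ := M

/-- The groupoid `GL^gr(D)` over `M`. -/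
instance (D : CorankOneDistribution E M) : CategoryTheory.Groupoid D.Base where
  Hom x y := D.GradedIso x y
  id x := ⟨LinearEquiv.refl ℝ _, LinearEquiv.refl ℝ _⟩
  comp γ δ := ⟨γ.deg1.trans δ.deg1, γ.deg2.trans δ.deg2⟩
  inv γ := ⟨γ.deg1.symm, γ.deg2.symm⟩
  inv_comp γ := GradedIso.ext γ.deg1.symm_trans_self γ.deg2.symm_trans_self
  comp_inv γ := GradedIso.ext γ.deg1.self_trans_symm γ.deg2.self_trans_symm

/-- The space of all arrows of `GL^gr(D)`. -/
structure GLgr (D : CorankOneDistribution E M) where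
  /-- the source of the arrow -/
  src : M
  /-- the target of the arrow -/
  tgt : M
  /-- the arrow itself -/
  iso : D.GradedIso src tgt

lemma finrank_quot (D : CorankOneDistribution E M) (x : M) :
    Module.finrank ℝ (D.Quot x) = 1 := by
  have : FiniteDimensional ℝ (TangentSpace 𝓘(ℝ, E) x) := inferInstanceAs (FiniteDimensional ℝ E)
  have h := (D.fiber x).finrank_quotient_add_finrank
  have h2 : Module.finrank ℝ (TangentSpace 𝓘(ℝ, E) x) = Module.finrank ℝ E := rfl
  have h3 := D.corank_one x
  have h4 : Module.finrank ℝ (D.Quot x) =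
    Module.finrank ℝ (TangentSpace 𝓘(ℝ, E) x ⧸ D.fiber x) := rfl
  omega

/-- A local smooth frame of `gr(TM)` on an open set: a frame `e` of `D` and a vector field `f`
whose class generates `TM / D`. -/
structure GradedFrame (D : CorankOneDistribution E M) where
  /-- the domain of the frame -/
  dom : Set M
  isOpen_dom : IsOpen dom
  /-- the frame of `D` -/
  e : Fin (Module.finrank ℝ E - 1) → ∀ x : M, D.fiber x
  /-- the transverse vector field -/
  f : ∀ x : M, TangentSpace 𝓘(ℝ, E) x
  smooth_e : ∀ i, SmoothSectionOn D.fiber (e i) dom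
  smooth_f : ContMDiffOn 𝓘(ℝ, E) 𝓘(ℝ, E).tangent ∞
    (fun x : M => (⟨x, f x⟩ : TangentBundle 𝓘(ℝ, E) M)) dom
  linearIndependent : ∀ x ∈ dom, LinearIndependent ℝ (fun i => e i x)
  notMem : ∀ x ∈ dom, f x ∉ D.fiber x

namespace GradedFrame

/-- Coordinates on `D_x` in a graded frame. -/
def equiv1 {D : CorankOneDistribution E M} (F : D.GradedFrame) (x : F.dom) :
    D.fiber x ≃ₗ[ℝ] (Fin (Module.finrank ℝ E - 1) → ℝ) :=
  (D.basisOf x _ (F.linearIndependent x x.2)).equivFun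

/-- The isomorphism `ℝ → T_x M / D_x`, `c ↦ c • [f_x]`, given by a graded frame. -/
def equiv2 {D : CorankOneDistribution E M} (F : D.GradedFrame) (x : F.dom) :
    ℝ ≃ₗ[ℝ] D.Quot x :=
  have : FiniteDimensional ℝ (D.Quot x) :=
    Module.finite_of_finrank_pos (by rw [D.finrank_quot]; exact one_pos)
  LinearEquiv.ofInjectiveOfFinrankEq
    (LinearMap.toSpanSingleton ℝ (D.Quot x) ((D.fiber x).mkQ (F.f x)))
    (by
      refine smul_left_injective ℝ (fun h => F.notMem x x.2 ?_)
      simpa using h)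
    (by rw [D.finrank_quot, Module.finrank_self])

/-- The parametrization `U × V × GL(r) × ℝˣ → GL^gr(D)` of the arrows from `U` to `V` given by
graded frames over `U` and `V`: an arrow is described by its source, its target and its matrices
in these frames. -/
def arrow {D : CorankOneDistribution E M} (F F' : D.GradedFrame)
    (p : F.dom × F'.dom × GL (Fin (Module.finrank ℝ E - 1)) ℝ × ℝˣ) : D.GLgr where
  src := p.1
  tgt := p.2.1
  iso :=
    { deg1 := (F.equiv1 p.1).trans
        ((Matrix.GeneralLinearGroup.toLin p.2.2.1).toLinearEquiv.trans (F'.equiv1 p.2.1).symm)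
      deg2 := (F.equiv2 p.1).symm.trans
        ((LinearEquiv.smulOfUnit p.2.2.2).trans (F'.equiv2 p.2.1)) }

end GradedFrame

/-- The topology of the Lie groupoid `GL^gr(D)`: a set of arrows is open if and only if it is open
in all the charts `U × V × GL(r) × ℝˣ`. -/
instance (D : CorankOneDistribution E M) : TopologicalSpace D.GLgr :=
  ⨆ (F : D.GradedFrame) (F' : D.GradedFrame),
    TopologicalSpace.coinduced (GradedFrame.arrow F F') inferInstance

end CorankOneDistribution

namespace CorankOneSubRiemannian

lemma exists_levi_ne_zero (S : CorankOneSubRiemannian E M) (x : M) :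
    ∃ v w : S.fiber x, S.levi x v w ≠ 0 := by
  obtain ⟨U, hU, hx, X, Y, hX, hY, hXY⟩ := S.nonintegrable x
  refine ⟨X x, Y x, ?_⟩
  rw [S.levi_apply x X Y ((hX.contMDiffAt (hU.mem_nhds hx)).mdifferentiableAt (by simp))
    ((hY.contMDiffAt (hU.mem_nhds hx)).mdifferentiableAt (by simp))]
  simpa using hXY

lemma metric_nondegenerate (S : CorankOneSubRiemannian E M) (x : M) :
    (S.metric x).Nondegenerate := by
  refine ⟨fun v hv => ?_, fun v hv => ?_⟩
  all_goals
    by_contra h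
    have := S.metric_pos x v h
    rw [hv v] at this
    exact lt_irrefl _ this

/-- A generator `θ_x : T_x M / D_x ≃ ℝ` of the annihilator of `D_x`. -/
def coform (S : CorankOneSubRiemannian E M) (x : M) :
    S.toCorankOneDistribution.Quot x ≃ₗ[ℝ] ℝ :=
  have : FiniteDimensional ℝ (S.toCorankOneDistribution.Quot x) :=
    Module.finite_of_finrank_pos (by rw [S.finrank_quot]; exact one_pos)
  LinearEquiv.ofFinrankEq _ _ (by rw [S.finrank_quot, Module.finrank_self])

/-- The two-form `ω_x = (dθ)_x` on `D_x`, that is `ω(X, Y) = -θ([X, Y])`. -/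
def omega (S : CorankOneSubRiemannian E M) (x : M) : LinearMap.BilinForm ℝ (S.fiber x) :=
  -(S.levi x).compr₂ (S.coform x).toLinearMap

/-- The endomorphism `J_x` of `D_x` with `g(J v, w) = ω(v, w)`. Replacing `θ_x` by another
generator multiplies `J_x` by a non-zero number. -/
def J (S : CorankOneSubRiemannian E M) (x : M) : S.fiber x →ₗ[ℝ] S.fiber x :=
  ((S.metric x).toDual (S.metric_nondegenerate x)).symm.toLinearMap ∘ₗ S.omega x

lemma metric_J (S : CorankOneSubRiemannian E M) (x : M) (v w : S.fiber x) :
    S.metric x (S.J x v) w = S.omega x v w := by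
  rw [← LinearMap.BilinForm.toDual_def (S.metric_nondegenerate x)]
  simp [J]

/-- The imaginary parts of the complex eigenvalues of `J_x`, with multiplicity, in increasing
order. -/
def imaginaryParts (S : CorankOneSubRiemannian E M) (x : M) : List ℝ :=
  ((((S.J x).charpoly.map (algebraMap ℝ ℂ)).roots).map Complex.im).sort (· ≤ ·)

/-- The numbers `0 ≤ α_1 ≤ … ≤ α_n`, `n = ⌊rank D / 2⌋`, such that the eigenvalues of `J_x` are
`± i α_1, …, ± i α_n` (and an additional `0` if `D` has odd rank): the `n` largest imaginary
parts. -/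
def frequencies (S : CorankOneSubRiemannian E M) (x : M) :
    Fin ((Module.finrank ℝ E - 1) / 2) → ℝ :=
  fun j => (S.imaginaryParts x).getD
    ((Module.finrank ℝ E - 1) - (Module.finrank ℝ E - 1) / 2 + j) 0

lemma omega_swap (S : CorankOneSubRiemannian E M) (x : M) (v w : S.fiber x) :
    S.omega x v w = - S.omega x w v := by
  simp only [omega, LinearMap.neg_apply, LinearMap.compr₂_apply]
  rw [S.levi_swap x v w]
  simp

lemma J_ne_zero (S : CorankOneSubRiemannian E M) (x : M) : S.J x ≠ 0 := by
  intro h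
  obtain ⟨v, w, hvw⟩ := S.exists_levi_ne_zero x
  have h1 := S.metric_J x v w
  rw [h] at h1
  simp [omega] at h1
  exact hvw h1

/-- A non-zero skew endomorphism has a non-real eigenvalue. -/
lemma exists_root_im_ne_zero (S : CorankOneSubRiemannian E M) (x : M) :
    ∃ z ∈ ((S.J x).charpoly.map (algebraMap ℝ ℂ)).roots, z.im ≠ 0 := by
  by_contra! hcon
  have hmon := (S.J x).charpoly_monic
  have hz : ∀ z ∈ ((S.J x).charpoly.map (algebraMap ℝ ℂ)).roots, z = 0 := by
    intro z hz
    have him := hcon z hz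
    have hzr : z = ((z.re : ℝ) : ℂ) := Complex.ext rfl (by simp [him])
    have hroot : (S.J x).charpoly.IsRoot z.re := by
      have h1 := (Polynomial.mem_roots'.1 hz).2
      rw [hzr] at h1
      have h2 : (((S.J x).charpoly.eval z.re : ℝ) : ℂ) = 0 := by
        rw [Polynomial.IsRoot, Polynomial.eval_map] at h1
        rw [← h1]
        exact (Polynomial.hom_eval₂ _ (RingHom.id ℝ) (algebraMap ℝ ℂ) z.re)
      exact_mod_cast h2
    obtain ⟨v, hv⟩ := ((Module.End.hasEigenvalue_iff_isRoot_charpoly _ _).2 hroot).exists_hasEigenvector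
    have h3 := S.metric_J x v v
    have h4 : S.omega x v v = 0 := by
      have := S.omega_swap x v v
      linarith
    rw [hv.apply_eq_smul, h4] at h3
    simp only [map_smul, LinearMap.smul_apply, smul_eq_mul] at h3
    have h5 := S.metric_pos x v hv.2
    have h6 : z.re = 0 := by
      rcases mul_eq_zero.1 h3 with h | h
      · exact h
      · exact absurd h h5.ne'
    rw [hzr, h6]
    simp
  have hpow : (S.J x).charpoly.map (algebraMap ℝ ℂ) =
      Polynomial.X ^ ((S.J x).charpoly.map (algebraMap ℝ ℂ)).roots.card := by
    have h1 := (IsAlgClosed.splits ((S.J x).charpoly.map (algebraMap ℝ ℂ))).eq_prod_roots_of_monic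
      (hmon.map _)
    rw [Multiset.eq_replicate_card.2 hz] at h1
    simpa using h1
  set k := ((S.J x).charpoly.map (algebraMap ℝ ℂ)).roots.card
  have hpow' : (S.J x).charpoly = Polynomial.X ^ k := by
    apply Polynomial.map_injective (algebraMap ℝ ℂ) (algebraMap ℝ ℂ).injective
    simpa using hpow
  have hnil : (S.J x) ^ k = 0 := by
    have := (S.J x).aeval_self_charpoly
    rw [hpow'] at this
    simpa using this
  have hstep : ∀ v, S.J x (S.J x v) = 0 → S.J x v = 0 := by
    intro v hv
    by_contra hne
    have h1 := S.metric_pos x _ hne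
    rw [S.metric_J, S.omega_swap, ← S.metric_J, hv] at h1
    simp at h1
  have hdown : ∀ m v, ((S.J x) ^ m) v = 0 → S.J x v = 0 := by
    intro m
    induction m with
    | zero =>
      intro v hv
      have : v = 0 := by simpa using hv
      simp [this]
    | succ m ih =>
      intro v hv
      rw [pow_succ, Module.End.mul_apply] at hv
      exact hstep v (ih _ hv)
  exact S.J_ne_zero x (LinearMap.ext fun v => hdown k v (by rw [hnil]; rfl))

lemma frequencies_ne_zero (S : CorankOneSubRiemannian E M) (x : M) : S.frequencies x ≠ 0 := by
  set p := (S.J x).charpoly.map (algebraMap ℝ ℂ) with hp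
  have hp0 : p ≠ 0 := ((S.J x).charpoly_monic.map _).ne_zero
  have hconj : ∀ z ∈ p.roots, (starRingEnd ℂ) z ∈ p.roots := by
    intro z hz
    refine Polynomial.mem_roots'.2 ⟨hp0, ?_⟩
    have h1 := (Polynomial.mem_roots'.1 hz).2
    rw [Polynomial.IsRoot, hp, Polynomial.eval_map] at h1 ⊢
    have h2 := congrArg (starRingEnd ℂ) h1
    rw [Polynomial.hom_eval₂, map_zero] at h2
    rw [← h2]
    congr 1
    ext r
    simp
  have hlen : (S.imaginaryParts x).length = Module.finrank ℝ E - 1 := by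
    rw [imaginaryParts, Multiset.length_sort, Multiset.card_map, ← hp,
      (IsAlgClosed.splits p).natDegree_eq_card_roots.symm, hp,
      (S.J x).charpoly_monic.natDegree_map, LinearMap.charpoly_natDegree, S.finrank_fiber]
  have hmem : ∀ z ∈ p.roots, z.im ∈ S.imaginaryParts x := by
    intro z hz
    rw [imaginaryParts, Multiset.mem_sort]
    exact Multiset.mem_map_of_mem _ hz
  have hsorted : (S.imaginaryParts x).Pairwise (· ≤ ·) := Multiset.pairwise_sort _ _
  obtain ⟨z, hz, hzim⟩ := S.exists_root_im_ne_zero x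
  obtain ⟨a, ha, b, hb, hapos, hbneg⟩ : ∃ a ∈ S.imaginaryParts x, ∃ b ∈ S.imaginaryParts x,
      0 < a ∧ b < 0 := by
    rcases lt_or_gt_of_ne hzim with h | h
    · exact ⟨_, hmem _ (hconj z hz), _, hmem _ hz, by simpa using h, h⟩
    · exact ⟨_, hmem _ hz, _, hmem _ (hconj z hz), h, by simpa using h⟩
  obtain ⟨i, hi, rfl⟩ := List.getElem_of_mem ha
  obtain ⟨j, hj, rfl⟩ := List.getElem_of_mem hb
  have hij : j ≠ i := by
    rintro rfl
    exact absurd hapos (not_lt.2 hbneg.le)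
  set r := Module.finrank ℝ E - 1 with hr
  have hr2 : 2 ≤ r := by omega
  intro h0
  have h1 := congrFun h0 ⟨r / 2 - 1, by omega⟩
  simp only [frequencies, Pi.zero_apply] at h1
  rw [← hr, show r - r / 2 + (r / 2 - 1) = r - 1 by omega,
    List.getD_eq_getElem _ _ (by omega)] at h1
  have h2 : (S.imaginaryParts x)[i] ≤ (S.imaginaryParts x)[r - 1]'(by omega) := by
    rcases eq_or_lt_of_le (show i ≤ r - 1 by omega) with h | h
    · simp [h]
    · exact List.pairwise_iff_getElem.1 hsorted _ _ _ _ h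
  linarith

/-- The type map `α : M → ℝℙ^{n-1}`, `x ↦ [α_1 : … : α_n]`. -/
def type (S : CorankOneSubRiemannian E M) (x : M) :
    Projectivization ℝ (Fin ((Module.finrank ℝ E - 1) / 2) → ℝ) :=
  Projectivization.mk ℝ (S.frequencies x) (S.frequencies_ne_zero x)

/-- An arrow of `GL^gr(D)` is a sub-Riemannian symmetry if it is a Lie algebra isomorphism
`gr(T_x M) → gr(T_y M)` and its component `D_x → D_y` is an isometry. -/
def IsSymmetry (S : CorankOneSubRiemannian E M) {x y : M}
    (γ : S.toCorankOneDistribution.GradedIso x y) : Prop :=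
  (∀ a b : S.toCorankOneDistribution.Gr x, γ.map ⁅a, b⁆ = ⁅γ.map a, γ.map b⁆) ∧
    ∀ v w : S.fiber x, S.metric y (γ.deg1 v) (γ.deg1 w) = S.metric x v w

lemma isSymmetry_inv (S : CorankOneSubRiemannian E M) {x y : M}
    (γ : S.toCorankOneDistribution.GradedIso x y) (h : S.IsSymmetry γ) :
    S.IsSymmetry (⟨γ.deg1.symm, γ.deg2.symm⟩ : S.toCorankOneDistribution.GradedIso y x) := by
  refine ⟨fun a b => ?_, fun v w => ?_⟩
  · have hm : ∀ a, γ.map (CorankOneDistribution.GradedIso.map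
        (⟨γ.deg1.symm, γ.deg2.symm⟩ : S.toCorankOneDistribution.GradedIso y x) a) = a := fun a =>
      Prod.ext (γ.deg1.apply_symm_apply _) (γ.deg2.apply_symm_apply _)
    have hinj : Function.Injective γ.map := fun a b hab =>
      Prod.ext (γ.deg1.injective (congrArg Prod.fst hab)) (γ.deg2.injective (congrArg Prod.snd hab))
    apply hinj
    rw [h.1, hm, hm, hm]
  · rw [← h.2]
    simp

lemma isSymmetry_comp (S : CorankOneSubRiemannian E M) {x y z : M}
    (γ : S.toCorankOneDistribution.GradedIso x y) (δ : S.toCorankOneDistribution.GradedIso y z)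
    (h : S.IsSymmetry γ) (h' : S.IsSymmetry δ) :
    S.IsSymmetry (⟨γ.deg1.trans δ.deg1, γ.deg2.trans δ.deg2⟩ :
      S.toCorankOneDistribution.GradedIso x z) := by
  refine ⟨fun a b => ?_, fun v w => ?_⟩
  · change δ.map (γ.map ⁅a, b⁆) = ⁅δ.map (γ.map a), δ.map (γ.map b)⁆
    rw [h.1, h'.1]
  · rw [← h.2, ← h'.2]
    rfl

/-- The groupoid `𝒢` of sub-Riemannian symmetries, as a subgroupoid of `GL^gr(D)`. -/
def symmetries (S : CorankOneSubRiemannian E M) :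
    CategoryTheory.Subgroupoid S.toCorankOneDistribution.Base where
  arrows _ _ := {γ | S.IsSymmetry γ}
  inv := by
    rintro x y γ h
    exact isSymmetry_inv S γ h
  mul := by
    rintro x y z γ h δ h'
    exact isSymmetry_comp S γ δ h h'

/-- The space of arrows of `𝒢`, with the topology induced from `GL^gr(D)`. -/
def SymmetryGroupoid (S : CorankOneSubRiemannian E M) : Type _ :=
  {γ : S.toCorankOneDistribution.GLgr // γ.iso ∈ S.symmetries.arrows γ.src γ.tgt}

instance (S : CorankOneSubRiemannian E M) : TopologicalSpace S.SymmetryGroupoid :=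
  inferInstanceAs (TopologicalSpace
    {γ : S.toCorankOneDistribution.GLgr // γ.iso ∈ S.symmetries.arrows γ.src γ.tgt})

/-- The anchor `(s, t) : 𝒢 → M × M`. -/
def anchor (S : CorankOneSubRiemannian E M) (γ : S.SymmetryGroupoid) : M × M :=
  (γ.1.src, γ.1.tgt)

end CorankOneSubRiemannian

end Levi

end SubRiemannian

end

/-! In graded frames near two points a symmetry is a pair `(A, c)`, with `A` an invertible matrix
and `c` a non-zero scalar, such that `Aᵀ G' A = G` and `c L = Aᵀ L' A`. Here `G`, `G'` are the Gram
matrices and `L`, `L'` the Levi matrices at source and target (`isSymmetry_arrow_iff`); all four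
depend continuously on the point. Properness is tested on an ultrafilter of arrows whose endpoints
converge. Positivity of the limit of `G'` bounds the columns of `A`, so `A` converges, and
positivity of the limit of `G` makes its limit invertible. Since the Levi map vanishes nowhere, `c`
is eventually a quotient of convergent entries, and its limit is non-zero because the limit of `L'`
is. Both equations survive in the limit, which is therefore a symmetry
(`exists_tendsto_coordinates`).

For the image, a symmetry from `x` to `y` amounts to an isometry `D_x → D_y` conjugating `c J_x` to
`J_y` for some `c ≠ 0`. Skew endomorphisms of Euclidean spaces are classified up to isometry by
their characteristic polynomial (`IsSkew.exists_isometry`): split off a kernel line or an invariant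
plane and induct on the dimension. The spectrum of `J` is purely imaginary and symmetric under
negation, so it is determined by the frequencies and the parity of the rank, and equal types mean
proportional spectra (`type_eq_iff`).

Compactness of the isotropy groups and closedness of the image are then formal consequences of
properness. -/

noncomputable section

namespace SubRiemannian

/-! ### Skew endomorphisms of Euclidean spaces up to isometry -/

section SkewNormalForm

/-- The roots of the characteristic polynomial over `ℂ` of a real endomorphism. -/
def complexRoots {V : Type*} [AddCommGroup V] [Module ℝ V] [FiniteDimensional ℝ V]
    (f : V →ₗ[ℝ] V) : Multiset ℂ :=
  (f.charpoly.map (algebraMap ℝ ℂ)).roots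

/-- Over an infinite field it suffices to compare values, and every real number is `c * s` because
`c ≠ 0`; there the identity reads `det (cs - cf) = c ^ dim V * det (s - f)`. -/
lemma charpoly_smul_eq_scaleRoots {V : Type*} [AddCommGroup V] [Module ℝ V]
    [FiniteDimensional ℝ V] (f : V →ₗ[ℝ] V) {c : ℝ} (hc : c ≠ 0) :
    (c • f).charpoly = f.charpoly.scaleRoots c := by
  refine Polynomial.funext fun t => ?_
  obtain ⟨s, rfl⟩ : ∃ s, t = c * s := ⟨c⁻¹ * t, by field_simp⟩
  have h := Polynomial.scaleRoots_eval₂_mul (p := f.charpoly) (RingHom.id ℝ) (r := s) (s := c)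
  simp only [RingHom.id_apply, Polynomial.eval₂_id] at h
  rw [h, LinearMap.eval_charpoly, LinearMap.eval_charpoly, LinearMap.charpoly_natDegree,
    ← LinearMap.det_smul]
  congr 1
  ext v
  simp [smul_sub, smul_comm s c v]

lemma complexRoots_smul {V : Type*} [AddCommGroup V] [Module ℝ V] [FiniteDimensional ℝ V]
    (f : V →ₗ[ℝ] V) {c : ℝ} (hc : c ≠ 0) :
    complexRoots (c • f) = (complexRoots f).map ((c : ℂ) * ·) := by
  unfold complexRoots
  rw [charpoly_smul_eq_scaleRoots f hc, Polynomial.map_scaleRoots _ _ _ (by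
    simp [f.charpoly_monic.leadingCoeff])]
  exact Polynomial.roots_scaleRoots _ (by simpa using hc)

/-- A monic polynomial over `ℂ` is the product of its root factors, and extension of coefficients
from `ℝ` to `ℂ` is injective. -/
lemma charpoly_eq_of_complexRoots_eq {V W : Type*} [AddCommGroup V] [Module ℝ V]
    [FiniteDimensional ℝ V] [AddCommGroup W] [Module ℝ W] [FiniteDimensional ℝ W]
    {f : V →ₗ[ℝ] V} {g : W →ₗ[ℝ] W} (h : complexRoots f = complexRoots g) :
    f.charpoly = g.charpoly := by
  apply Polynomial.map_injective (algebraMap ℝ ℂ) (algebraMap ℝ ℂ).injective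
  rw [(IsAlgClosed.splits _).eq_prod_roots_of_monic (f.charpoly_monic.map (algebraMap ℝ ℂ)),
    (IsAlgClosed.splits _).eq_prod_roots_of_monic (g.charpoly_monic.map (algebraMap ℝ ℂ))]
  unfold complexRoots at h
  rw [h]

/-- Real and imaginary parts of an eigenvector for a complex eigenvalue. -/
lemma exists_re_im_eigenvector {V : Type*} [AddCommGroup V] [Module ℝ V] [FiniteDimensional ℝ V]
    (f : V →ₗ[ℝ] V) {z : ℂ} (hz : z ∈ complexRoots f) :
    ∃ u w : V, (u ≠ 0 ∨ w ≠ 0) ∧ f u = z.re • u - z.im • w ∧ f w = z.im • u + z.re • w := by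
  let b := Module.finBasis ℝ V
  let A := LinearMap.toMatrix b b f
  have h0 := (Polynomial.mem_roots'.1 hz).2
  rw [← LinearMap.charpoly_toMatrix f b, ← Matrix.charpoly_map, Polynomial.IsRoot,
    Matrix.eval_charpoly] at h0
  -- A kernel vector of `z - A` over `ℂ`; the two real equations are the real and imaginary parts of
  -- `z v = A v`.
  obtain ⟨v, hv0, hv⟩ := Matrix.exists_mulVec_eq_zero_iff.2 h0
  rw [Matrix.sub_mulVec, sub_eq_zero] at hv
  have hv' : ∀ i, z * v i = ∑ j, (A i j : ℂ) * v j := by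
    intro i
    have := congrFun hv i
    simpa [Matrix.mulVec, dotProduct, Matrix.scalar_apply, Matrix.diagonal_apply] using this
  have hrepr : ∀ x : Fin (Module.finrank ℝ V) → ℝ, f (b.equivFun.symm x) =
      b.equivFun.symm (A.mulVec x) := by
    intro x
    apply b.equivFun.injective
    rw [LinearEquiv.apply_symm_apply]
    have := LinearMap.toMatrix_mulVec_repr b b f (b.equivFun.symm x)
    rw [Module.Basis.equivFun_apply, ← this]
    congr 1
    ext i
    rw [← Module.Basis.equivFun_apply, LinearEquiv.apply_symm_apply]
  refine ⟨b.equivFun.symm fun i => (v i).re, b.equivFun.symm fun i => (v i).im, ?_, ?_, ?_⟩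
  · by_contra! hcon
    apply hv0
    have h1 := b.equivFun.symm.map_eq_zero_iff.1 hcon.1
    have h2 := b.equivFun.symm.map_eq_zero_iff.1 hcon.2
    exact funext fun i => Complex.ext (congrFun h1 i) (congrFun h2 i)
  · rw [hrepr, ← map_smul, ← map_smul, ← map_sub]
    congr 1
    ext i
    have := congrArg Complex.re (hv' i)
    simpa [Matrix.mulVec, dotProduct] using this.symm
  · rw [hrepr, ← map_smul, ← map_smul, ← map_add]
    congr 1
    ext i
    have := congrArg Complex.im (hv' i)
    simp only [Complex.mul_im, Complex.im_sum, Complex.ofReal_re, Complex.ofReal_im] at this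
    simp only [Matrix.mulVec, dotProduct, Pi.add_apply, Pi.smul_apply, smul_eq_mul]
    rw [add_comm, this]
    simp

variable {V W : Type*} [NormedAddCommGroup V] [InnerProductSpace ℝ V] [FiniteDimensional ℝ V]
  [NormedAddCommGroup W] [InnerProductSpace ℝ W] [FiniteDimensional ℝ W]

open scoped InnerProductSpace

/-- Skew endomorphisms of a Euclidean space. -/
def IsSkew (f : V →ₗ[ℝ] V) : Prop := ∀ v w, ⟪f v, w⟫_ℝ = -⟪v, f w⟫_ℝ

lemma IsSkew.inner_self {f : V →ₗ[ℝ] V} (hf : IsSkew f) (v : V) : ⟪f v, v⟫_ℝ = 0 := by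
  have := hf v v
  rw [real_inner_comm] at this
  linarith [real_inner_comm v (f v)]

/-- For an eigenvector `u + i w`, the cross terms cancel in `0 = ⟪f u, u⟫ + ⟪f w, w⟫ = re z * (‖u‖²
+ ‖w‖²)`. -/
lemma IsSkew.re_eq_zero {f : V →ₗ[ℝ] V} (hf : IsSkew f) {z : ℂ} (hz : z ∈ complexRoots f) :
    z.re = 0 := by
  obtain ⟨u, w, hne, hu, hw⟩ := exists_re_im_eigenvector f hz
  have h1 := hf.inner_self u
  have h2 := hf.inner_self w
  rw [hu, inner_sub_left, inner_smul_left, inner_smul_left] at h1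
  rw [hw, inner_add_left, inner_smul_left, inner_smul_left] at h2
  simp only [conj_trivial] at h1 h2
  rw [real_inner_comm] at h2
  have h3 : z.re * (⟪u, u⟫_ℝ + ⟪w, w⟫_ℝ) = 0 := by linarith [real_inner_comm u w]
  rcases mul_eq_zero.1 h3 with h | h
  · exact h
  · have := real_inner_self_nonneg (x := u)
    have := real_inner_self_nonneg (x := w)
    rcases hne with h' | h'
    · exact absurd (inner_self_eq_zero.1 (by linarith : ⟪u, u⟫_ℝ = 0)) h'
    · exact absurd (inner_self_eq_zero.1 (by linarith : ⟪w, w⟫_ℝ = 0)) h'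

/-- A skew endomorphism with eigenvalue `iλ`, `λ ≠ 0`, has an invariant plane. -/
lemma IsSkew.exists_plane {f : V →ₗ[ℝ] V} (hf : IsSkew f) {z : ℂ} (hz : z ∈ complexRoots f) :
    ∃ v : V, ⟪v, v⟫_ℝ = 1 ∧ f (f v) = -(z.im ^ 2) • v := by
  obtain ⟨u, w, hne, hu, hw⟩ := exists_re_im_eigenvector f hz
  rw [hf.re_eq_zero hz] at hu hw
  simp only [zero_smul, zero_sub, add_zero] at hu hw
  -- Since `f u = -λ w` and `f w = λ u`, with `λ = z.im`, the square of `f` is `-λ²` on both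
  -- vectors; whichever is non-zero serves.
  have key : ∃ v : V, v ≠ 0 ∧ f (f v) = -(z.im ^ 2) • v := by
    rcases hne with h | h
    · exact ⟨u, h, by rw [hu, map_neg, map_smul, hw, smul_smul, neg_smul, sq]⟩
    · exact ⟨w, h, by rw [hw, map_smul, hu, smul_neg, smul_smul, neg_smul, sq]⟩
  obtain ⟨v, hv, hfv⟩ := key
  refine ⟨‖v‖⁻¹ • v, ?_, ?_⟩
  · rw [real_inner_self_eq_norm_sq, norm_smul, norm_inv, norm_norm,
      inv_mul_cancel₀ (norm_ne_zero_iff.2 hv), one_pow]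
  · rw [map_smul, map_smul, hfv, smul_comm]

/-- An invariant subspace of a skew endomorphism, parametrized by `F`, splits off. -/
lemma IsSkew.exists_splitting {F : Type*} [AddCommGroup F] [Module ℝ F]
    {f : V →ₗ[ℝ] V} (hf : IsSkew f) (φ : F →ₗ[ℝ] V) (hφ : Function.Injective φ)
    (R : F →ₗ[ℝ] F) (hR : ∀ a, f (φ a) = φ (R a)) :
    ∃ (Q : Submodule ℝ V) (fQ : Q →ₗ[ℝ] Q) (Φ : (F × Q) ≃ₗ[ℝ] V), IsSkew fQ ∧
      (∀ p, f (Φ p) = Φ (R.prodMap fQ p)) ∧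
      ∀ p q, ⟪Φ p, Φ q⟫_ℝ = ⟪φ p.1, φ q.1⟫_ℝ + ⟪p.2, q.2⟫_ℝ := by
  -- Skewness moves `f` to the other slot of the inner product, where it preserves the range of `φ`.
  have hinv : ∀ q ∈ (LinearMap.range φ)ᗮ, f q ∈ (LinearMap.range φ)ᗮ := by
    intro q hq
    rw [Submodule.mem_orthogonal] at hq ⊢
    rintro _ ⟨a, rfl⟩
    have h1 := hf (φ a) q
    rw [hR, hq _ ⟨_, rfl⟩] at h1
    linarith
  have hc : IsCompl (LinearMap.range φ) (LinearMap.range φ)ᗮ :=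
    Submodule.isCompl_orthogonal _
  let Φ : (F × (LinearMap.range φ)ᗮ) ≃ₗ[ℝ] V :=
    ((LinearEquiv.ofInjective φ hφ).prodCongr (LinearEquiv.refl ℝ _)).trans
      (Submodule.prodEquivOfIsCompl _ _ hc)
  have hΦ : ∀ p, Φ p = φ p.1 + p.2 := fun p => rfl
  refine ⟨(LinearMap.range φ)ᗮ, f.restrict hinv, Φ, fun v w => hf v w, fun p => ?_, fun p q => ?_⟩
  · rw [hΦ, hΦ, map_add, hR]
    rfl
  · rw [hΦ, hΦ, inner_add_left, inner_add_right, inner_add_right,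
      (Submodule.mem_orthogonal _ _).1 q.2.2 _ ⟨_, rfl⟩,
      (Submodule.mem_orthogonal' _ _).1 p.2.2 _ ⟨_, rfl⟩, add_zero, zero_add, Submodule.coe_inner]

/-- The endomorphism `(a, b) ↦ (-l b, a)` of the plane. -/
def planeMap (l : ℝ) : (ℝ × ℝ) →ₗ[ℝ] (ℝ × ℝ) :=
  (-l • LinearMap.snd ℝ ℝ ℝ).prod (LinearMap.fst ℝ ℝ ℝ)

lemma planeMap_apply (l : ℝ) (a : ℝ × ℝ) : planeMap l a = (-l * a.2, a.1) := rfl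

/-- A complex root of the characteristic polynomial of a skew endomorphism provides an invariant
subspace isometric to a model that only depends on the root. -/
lemma IsSkew.exists_model {f : V →ₗ[ℝ] V} (hf : IsSkew f) {z : ℂ} (hz : z ∈ complexRoots f) :
    (z.im = 0 → ∃ φ : ℝ →ₗ[ℝ] V, (∀ a b, ⟪φ a, φ b⟫_ℝ = a * b) ∧
      ∀ a, f (φ a) = φ ((0 : ℝ →ₗ[ℝ] ℝ) a)) ∧
    ∃ φ : (ℝ × ℝ) →ₗ[ℝ] V, (∀ a b, ⟪φ a, φ b⟫_ℝ = a.1 * b.1 + z.im ^ 2 * (a.2 * b.2)) ∧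
      ∀ a, f (φ a) = φ (planeMap (z.im ^ 2) a) := by
  obtain ⟨v, hv, hfv⟩ := hf.exists_plane hz
  have h1 : ⟪f v, f v⟫_ℝ = z.im ^ 2 := by
    rw [hf, hfv, inner_smul_right, hv]
    simp
  have h2 := hf.inner_self v
  -- The plane is spanned by `v` and the unnormalized `f v`, which avoids dividing by `z.im`. If
  -- `z.im = 0` the second map is degenerate, and the line through `v` replaces it.
  refine ⟨fun h0 => ⟨LinearMap.toSpanSingleton ℝ V v, fun a b => ?_, fun a => ?_⟩,
    (LinearMap.toSpanSingleton ℝ V v).coprod (LinearMap.toSpanSingleton ℝ V (f v)),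
    fun a b => ?_, fun a => ?_⟩
  · simp only [LinearMap.toSpanSingleton_apply, inner_smul_left, inner_smul_right, hv,
      conj_trivial]
    ring
  · rw [h0] at h1
    have h3 : f v = 0 := inner_self_eq_zero.1 (h1.trans (by simp))
    simp [h3]
  · simp only [LinearMap.coprod_apply, LinearMap.toSpanSingleton_apply, inner_add_left,
      inner_add_right, inner_smul_left, inner_smul_right, hv, h1, h2, real_inner_comm (f v) v,
      conj_trivial]
    ring
  · simp only [LinearMap.coprod_apply, LinearMap.toSpanSingleton_apply, planeMap_apply,
      map_add, map_smul, hfv, smul_smul]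
    rw [add_comm]
    congr 2
    ring

/-- Reduction of the conjugacy of skew endomorphisms to the complements of invariant subspaces. -/
lemma exists_isometry_of_model {F : Type*} [AddCommGroup F] [Module ℝ F] [FiniteDimensional ℝ F]
    (hF : 0 < Module.finrank ℝ F) (R : F →ₗ[ℝ] F) {f : V →ₗ[ℝ] V} (hf : IsSkew f)
    {g : W →ₗ[ℝ] W} (hg : IsSkew g) (h : f.charpoly = g.charpoly)
    (φ : F →ₗ[ℝ] V) (hφ : Function.Injective φ) (hφR : ∀ a, f (φ a) = φ (R a))
    (ψ : F →ₗ[ℝ] W) (hψ : Function.Injective ψ) (hψR : ∀ a, g (ψ a) = ψ (R a))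
    (hφψ : ∀ a b, ⟪ψ a, ψ b⟫_ℝ = ⟪φ a, φ b⟫_ℝ)
    (ih : ∀ (Q : Submodule ℝ V) (Q' : Submodule ℝ W) (fQ : Q →ₗ[ℝ] Q) (gQ : Q' →ₗ[ℝ] Q'),
      Module.finrank ℝ Q < Module.finrank ℝ V → IsSkew fQ → IsSkew gQ →
      fQ.charpoly = gQ.charpoly →
      ∃ A : Q ≃ₗ[ℝ] Q', (∀ v w, ⟪A v, A w⟫_ℝ = ⟪v, w⟫_ℝ) ∧ ∀ v, A (fQ v) = gQ (A v)) :
    ∃ A : V ≃ₗ[ℝ] W, (∀ v w, ⟪A v, A w⟫_ℝ = ⟪v, w⟫_ℝ) ∧ ∀ v, A (f v) = g (A v) := by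
  obtain ⟨Q, fQ, Φ, hfQ, hΦ, hΦi⟩ := hf.exists_splitting φ hφ R hφR
  obtain ⟨Q', gQ, Ψ, hgQ, hΨ, hΨi⟩ := hg.exists_splitting ψ hψ R hψR
  have e1 : f = Φ.conj (R.prodMap fQ) := by
    ext v
    obtain ⟨p, rfl⟩ := Φ.surjective v
    rw [hΦ, LinearEquiv.conj_apply_apply, LinearEquiv.symm_apply_apply]
  have e2 : g = Ψ.conj (R.prodMap gQ) := by
    ext v
    obtain ⟨p, rfl⟩ := Ψ.surjective v
    rw [hΨ, LinearEquiv.conj_apply_apply, LinearEquiv.symm_apply_apply]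
  -- The characteristic polynomial is multiplicative on the splitting, so the common factor
  -- contributed by `R` cancels.
  have hcp : fQ.charpoly = gQ.charpoly := by
    rw [e1, e2, LinearEquiv.charpoly_conj, LinearEquiv.charpoly_conj, LinearMap.charpoly_prodMap,
      LinearMap.charpoly_prodMap] at h
    exact mul_left_cancel₀ R.charpoly_monic.ne_zero h
  have hlt : Module.finrank ℝ Q < Module.finrank ℝ V := by
    rw [← Φ.finrank_eq, Module.finrank_prod]
    omega
  obtain ⟨A, hA, hAf⟩ := ih Q Q' fQ gQ hlt hfQ hgQ hcp
  refine ⟨Φ.symm.trans (((LinearEquiv.refl ℝ F).prodCongr A).trans Ψ), fun v w => ?_, fun v => ?_⟩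
  · obtain ⟨p, rfl⟩ := Φ.surjective v
    obtain ⟨q, rfl⟩ := Φ.surjective w
    simp only [LinearEquiv.trans_apply, LinearEquiv.symm_apply_apply]
    rw [hΨi, hΦi]
    simp [hφψ, hA]
  · obtain ⟨p, rfl⟩ := Φ.surjective v
    rw [hΦ]
    simp only [LinearEquiv.trans_apply, LinearEquiv.symm_apply_apply]
    rw [hΨ]
    simp [hAf]

/-- Skew endomorphisms of Euclidean spaces with the same characteristic polynomial are
conjugate by an isometry. -/
theorem IsSkew.exists_isometry {f : V →ₗ[ℝ] V} (hf : IsSkew f) {g : W →ₗ[ℝ] W} (hg : IsSkew g)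
    (h : f.charpoly = g.charpoly) :
    ∃ A : V ≃ₗ[ℝ] W, (∀ v w, ⟪A v, A w⟫_ℝ = ⟪v, w⟫_ℝ) ∧ ∀ v, A (f v) = g (A v) := by
  -- The spaces vary in the induction, since the hypothesis is applied to orthogonal complements.
  induction hn : Module.finrank ℝ V using Nat.strong_induction_on generalizing V W with
  | _ n ih =>
  have hdim : Module.finrank ℝ V = Module.finrank ℝ W := by
    rw [← f.charpoly_natDegree, ← g.charpoly_natDegree, h]
  have ih' : ∀ (Q : Submodule ℝ V) (Q' : Submodule ℝ W) (fQ : Q →ₗ[ℝ] Q) (gQ : Q' →ₗ[ℝ] Q'),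
      Module.finrank ℝ Q < Module.finrank ℝ V → IsSkew fQ → IsSkew gQ →
      fQ.charpoly = gQ.charpoly →
      ∃ A : Q ≃ₗ[ℝ] Q', (∀ v w, ⟪A v, A w⟫_ℝ = ⟪v, w⟫_ℝ) ∧ ∀ v, A (fQ v) = gQ (A v) :=
    fun Q Q' fQ gQ hlt hfQ hgQ hcp => ih _ (hn ▸ hlt) hfQ hgQ hcp rfl
  rcases Nat.eq_zero_or_pos n with h0 | hpos
  · have hV : Subsingleton V := Module.finrank_zero_iff.1 (hn.trans h0)
    refine ⟨LinearEquiv.ofFinrankEq V W hdim, fun v w => ?_, fun v => ?_⟩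
    · rw [Subsingleton.elim v 0]
      simp
    · rw [Subsingleton.elim v 0]
      simp
  -- In positive dimension the characteristic polynomial has a complex root; being shared with `g`,
  -- it gives both sides the same model.
  · obtain ⟨z, hz⟩ : ∃ z, z ∈ complexRoots f := by
      refine Multiset.exists_mem_of_ne_zero fun h1 => ?_
      have h2 := (IsAlgClosed.splits (f.charpoly.map (algebraMap ℝ ℂ))).natDegree_eq_card_roots
      unfold complexRoots at h1
      rw [h1, f.charpoly_monic.natDegree_map, f.charpoly_natDegree] at h2
      simp at h2
      omega
    have hz' : z ∈ complexRoots g := by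
      unfold complexRoots at hz ⊢
      rwa [← h]
    by_cases him : z.im = 0
    · obtain ⟨φ, hφ, hφR⟩ := (hf.exists_model hz).1 him
      obtain ⟨ψ, hψ, hψR⟩ := (hg.exists_model hz').1 him
      refine exists_isometry_of_model (by simp) _ hf hg h φ ?_ hφR ψ ?_ hψR
        (fun a b => by rw [hφ, hψ]) ih'
      · refine (injective_iff_map_eq_zero φ).2 fun a ha => ?_
        have := hφ a a
        rw [ha, inner_zero_left] at this
        exact mul_self_eq_zero.1 this.symm
      · refine (injective_iff_map_eq_zero ψ).2 fun a ha => ?_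
        have := hψ a a
        rw [ha, inner_zero_left] at this
        exact mul_self_eq_zero.1 this.symm
    -- The model form is definite when `z.im ≠ 0`, whence both parametrizations of invariant planes
    -- are injective.
    · have key : ∀ a : ℝ × ℝ, a.1 * a.1 + z.im ^ 2 * (a.2 * a.2) = 0 → a = 0 := by
        intro a ha
        have h1 : 0 < z.im ^ 2 := by positivity
        have h2 : a.1 * a.1 = 0 := by nlinarith [mul_self_nonneg a.1, mul_self_nonneg a.2]
        have h3 : z.im ^ 2 * (a.2 * a.2) = 0 := by linarith
        refine Prod.ext (mul_self_eq_zero.1 h2) (mul_self_eq_zero.1 ?_)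
        exact (mul_eq_zero.1 h3).resolve_left h1.ne'
      obtain ⟨φ, hφ, hφR⟩ := (hf.exists_model hz).2
      obtain ⟨ψ, hψ, hψR⟩ := (hg.exists_model hz').2
      refine exists_isometry_of_model (by simp) _ hf hg h φ ?_ hφR ψ ?_ hψR
        (fun a b => by rw [hφ, hψ]) ih'
      · refine (injective_iff_map_eq_zero φ).2 fun a ha => key a ?_
        rw [← hφ, ha, inner_zero_left]
      · refine (injective_iff_map_eq_zero ψ).2 fun a ha => key a ?_
        rw [← hψ, ha, inner_zero_left]

end SkewNormalForm

/-! ### Transfer to spaces with a positive definite bilinear form -/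

section BilinearForms

variable {V W : Type*} [AddCommGroup V] [Module ℝ V] [FiniteDimensional ℝ V]
  [AddCommGroup W] [Module ℝ W] [FiniteDimensional ℝ W]

/-- The inner product space core given by a positive definite symmetric bilinear form. -/
abbrev coreOfBilinForm (g : LinearMap.BilinForm ℝ V) (hs : ∀ v w, g v w = g w v)
    (hp : ∀ v, v ≠ 0 → 0 < g v v) : InnerProductSpace.Core ℝ V where
  inner v w := g v w
  conj_inner_symm v w := by simpa using hs w v
  re_inner_nonneg v := by
    rcases eq_or_ne v 0 with rfl | h
    · simp
    · simpa using (hp v h).le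
  add_left u v w := by simp
  smul_left u v r := by simp
  definite v h := by
    by_contra hv
    exact (hp v hv).ne' h

lemma re_eq_zero_of_skew (g : LinearMap.BilinForm ℝ V) (hs : ∀ v w, g v w = g w v)
    (hp : ∀ v, v ≠ 0 → 0 < g v v) (f : V →ₗ[ℝ] V) (hf : ∀ v w, g (f v) w = -g v (f w)) {z : ℂ}
    (hz : z ∈ complexRoots f) : z.re = 0 := by
  let _ : NormedAddCommGroup V := (coreOfBilinForm g hs hp).toNormedAddCommGroup
  let _ : InnerProductSpace ℝ V := InnerProductSpace.ofCore (coreOfBilinForm g hs hp).toCore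
  exact IsSkew.re_eq_zero (f := f) hf hz

/-- Endomorphisms, skew for positive definite forms, with the same characteristic polynomial are
conjugate by an isometry. -/
theorem exists_isometry_of_charpoly_eq (g : LinearMap.BilinForm ℝ V) (hs : ∀ v w, g v w = g w v)
    (hp : ∀ v, v ≠ 0 → 0 < g v v) (g' : LinearMap.BilinForm ℝ W) (hs' : ∀ v w, g' v w = g' w v)
    (hp' : ∀ v, v ≠ 0 → 0 < g' v v) (f : V →ₗ[ℝ] V) (hf : ∀ v w, g (f v) w = -g v (f w))
    (f' : W →ₗ[ℝ] W) (hf' : ∀ v w, g' (f' v) w = -g' v (f' w)) (h : f.charpoly = f'.charpoly) :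
    ∃ A : V ≃ₗ[ℝ] W, (∀ v w, g' (A v) (A w) = g v w) ∧ ∀ v, A (f v) = f' (A v) := by
  -- The norms are local to the proof, so the statement involves only the bilinear forms.
  let _ : NormedAddCommGroup V := (coreOfBilinForm g hs hp).toNormedAddCommGroup
  let _ : InnerProductSpace ℝ V := InnerProductSpace.ofCore (coreOfBilinForm g hs hp).toCore
  let _ : NormedAddCommGroup W := (coreOfBilinForm g' hs' hp').toNormedAddCommGroup
  let _ : InnerProductSpace ℝ W := InnerProductSpace.ofCore (coreOfBilinForm g' hs' hp').toCore
  exact IsSkew.exists_isometry (f := f) (g := f') hf hf' h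

end BilinearForms

/-! ### Sorted lists symmetric under negation -/

section SymmetricLists

/-- Negating and reversing gives a sorted permutation of the same list, hence the list itself. -/
lemma neg_getElem_of_symm {l : List ℝ} (hl : l.Pairwise (· ≤ ·))
    (hs : (l : Multiset ℝ).map (-·) = l) (k : ℕ) (hk : k < l.length) :
    l[k] = -l[l.length - 1 - k] := by
  have h1 : l = (l.map (-·)).reverse := by
    refine List.Perm.eq_of_pairwise' hl ?_ ?_
    · rw [List.pairwise_reverse, List.pairwise_map]
      exact hl.imp fun h => neg_le_neg h
    · refine (Multiset.coe_eq_coe.1 ?_).trans (List.reverse_perm _).symm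
      rw [← Multiset.map_coe, hs]
  conv_lhs => rw [List.getElem_of_eq h1]
  simp

/-- A sorted list symmetric under negation is determined by its upper half. -/
lemma coe_eq_of_symm {l : List ℝ} (hl : l.Pairwise (· ≤ ·))
    (hs : (l : Multiset ℝ).map (-·) = l) {n e : ℕ} (he : e ≤ 1) (hn : l.length = n + e + n)
    (F : Fin n → ℝ) (hF : ∀ j : Fin n, F j = l.getD (n + e + j) 0) :
    (l : Multiset ℝ) = (List.ofFn F : Multiset ℝ).map (-·) + Multiset.replicate e 0 +
      (List.ofFn F : Multiset ℝ) := by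
  have hF' : ∀ j : Fin n, F j = l[n + e + j]'(by omega) := fun j => by
    rw [hF, List.getD_eq_getElem]
  have h1 : l = ((List.ofFn F).map (-·)).reverse ++ List.replicate e 0 ++ List.ofFn F := by
    refine List.ext_getElem (by simp [hn, add_assoc]) fun k hk hk' => ?_
    rcases lt_or_ge k n with h | h
    · rw [List.getElem_append_left (by simp; omega), List.getElem_append_left (by simp; omega),
        neg_getElem_of_symm hl hs]
      simp only [List.getElem_reverse, List.length_map, List.length_ofFn, List.getElem_map,
        List.getElem_ofFn, hF']
      congr 2
      omega
    · rcases lt_or_ge k (n + e) with h' | h'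
      · rw [List.getElem_append_left (by simp; omega), List.getElem_append_right (by simp; omega)]
        -- This case is the middle position, possible only for `e = 1`: its mirror index is itself,
        -- so the entry equals its own negative.
        have h2 := neg_getElem_of_symm hl hs k hk
        have h3 : l[l.length - 1 - k] = l[k] := by
          congr 1
          omega
        rw [List.getElem_replicate]
        linarith
      · rw [List.getElem_append_right (by simp; omega)]
        simp only [List.getElem_ofFn, hF']
        congr 1
        simp
        omega
  conv_lhs => rw [h1]
  simp [← Multiset.coe_add, ← Multiset.coe_replicate, add_assoc]

/-- The sign of `c` is absorbed by the symmetry, leaving a factor that preserves the order. -/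
lemma map_mul_abs_of_symm {s : Multiset ℝ} (hs : s.map (-·) = s) (c : ℝ) :
    s.map (c * ·) = s.map (|c| * ·) := by
  rcases abs_choice c with h | h
  · rw [h]
  · conv_lhs => rw [← hs]
    rw [h, Multiset.map_map]
    simp

/-- Scaling a symmetric multiset by `c` scales the sorted list by `|c|`. -/
lemma sorted_eq_map_of_symm {l l' : List ℝ} (hl : l.Pairwise (· ≤ ·)) (hl' : l'.Pairwise (· ≤ ·))
    (hs : (l : Multiset ℝ).map (-·) = l) {c : ℝ} (h : (l' : Multiset ℝ) = Multiset.map (c * ·) l) :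
    l' = l.map (|c| * ·) := by
  refine List.Perm.eq_of_pairwise' hl' ?_ ?_
  · rw [List.pairwise_map]
    exact hl.imp fun h => mul_le_mul_of_nonneg_left h (abs_nonneg c)
  · rw [← Multiset.coe_eq_coe, h, map_mul_abs_of_symm hs, Multiset.map_coe]

end SymmetricLists

/-! ### Symmetry of the complex spectrum of a real endomorphism -/

/-- The characteristic polynomial has real coefficients, so conjugation fixes it and permutes its
roots with multiplicity. -/
lemma complexRoots_map_conj {V : Type*} [AddCommGroup V] [Module ℝ V] [FiniteDimensional ℝ V]
    (f : V →ₗ[ℝ] V) : (complexRoots f).map (starRingEnd ℂ) = complexRoots f := by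
  unfold complexRoots
  rw [← (IsAlgClosed.splits (f.charpoly.map (algebraMap ℝ ℂ))).roots_map, Polynomial.map_map]
  congr 2
  ext r
  simp

lemma complexRoots_im_symm {V : Type*} [AddCommGroup V] [Module ℝ V] [FiniteDimensional ℝ V]
    (f : V →ₗ[ℝ] V) :
    ((complexRoots f).map Complex.im).map (-·) = (complexRoots f).map Complex.im := by
  conv_rhs => rw [← complexRoots_map_conj f]
  simp [Multiset.map_map]

lemma complexRoots_eq_map_im {V : Type*} [AddCommGroup V] [Module ℝ V] [FiniteDimensional ℝ V]
    {f : V →ₗ[ℝ] V} (hf : ∀ z ∈ complexRoots f, z.re = 0) :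
    complexRoots f = ((complexRoots f).map Complex.im).map fun t : ℝ => (t : ℂ) * Complex.I := by
  rw [Multiset.map_map]
  conv_lhs => rw [← Multiset.map_id (complexRoots f)]
  refine Multiset.map_congr rfl fun z hz => ?_
  apply Complex.ext <;> simp [hf z hz]

/-! ### The type map and the existence of symmetries -/

namespace CorankOneSubRiemannian

variable {E : Type*} [NormedAddCommGroup E] [NormedSpace ℝ E] [FiniteDimensional ℝ E]
  {M : Type*} [TopologicalSpace M] [ChartedSpace E M] [IsManifold 𝓘(ℝ, E) ∞ M]

lemma J_skew (S : CorankOneSubRiemannian E M) (x : M) (v w : S.fiber x) :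
    S.metric x (S.J x v) w = -S.metric x v (S.J x w) := by
  rw [S.metric_J, S.omega_swap, S.metric_symm x v, S.metric_J]

lemma re_eq_zero (S : CorankOneSubRiemannian E M) (x : M) :
    ∀ z ∈ complexRoots (S.J x), z.re = 0 := fun _ hz =>
  re_eq_zero_of_skew (S.metric x) (S.metric_symm x) (S.metric_pos x) (S.J x) (S.J_skew x) hz

lemma coe_imaginaryParts (S : CorankOneSubRiemannian E M) (x : M) :
    (S.imaginaryParts x : Multiset ℝ) = (complexRoots (S.J x)).map Complex.im :=
  Multiset.sort_eq _ _

lemma imaginaryParts_symm (S : CorankOneSubRiemannian E M) (x : M) :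
    (S.imaginaryParts x : Multiset ℝ).map (-·) = S.imaginaryParts x := by
  rw [coe_imaginaryParts, complexRoots_im_symm]

lemma imaginaryParts_sorted (S : CorankOneSubRiemannian E M) (x : M) :
    (S.imaginaryParts x).Pairwise (· ≤ ·) :=
  Multiset.pairwise_sort _ _

lemma length_imaginaryParts (S : CorankOneSubRiemannian E M) (x : M) :
    (S.imaginaryParts x).length = Module.finrank ℝ E - 1 := by
  rw [imaginaryParts, Multiset.length_sort, Multiset.card_map,
    (IsAlgClosed.splits _).natDegree_eq_card_roots.symm,
    (S.J x).charpoly_monic.natDegree_map, LinearMap.charpoly_natDegree, S.finrank_fiber]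

/-- The frequencies lose no spectral information. For rank `r` and `n = r / 2`, the offset `r - r /
2` in `frequencies` is `n + r % 2`, just past the negative half and the middle zero present in odd
rank. -/
lemma coe_imaginaryParts_eq (S : CorankOneSubRiemannian E M) (x : M) :
    (S.imaginaryParts x : Multiset ℝ) = (List.ofFn (S.frequencies x) : Multiset ℝ).map (-·) +
      Multiset.replicate ((Module.finrank ℝ E - 1) % 2) 0 +
      (List.ofFn (S.frequencies x) : Multiset ℝ) := by
  refine coe_eq_of_symm (S.imaginaryParts_sorted x) (S.imaginaryParts_symm x) (by omega)
    (by rw [S.length_imaginaryParts]; omega) _ fun j => ?_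
  unfold frequencies
  congr 1
  omega

/-- The type at two points agrees if and only if the endomorphisms `J` have the same spectrum up
to a non-zero factor. -/
lemma type_eq_iff (S : CorankOneSubRiemannian E M) (x y : M) :
    S.type x = S.type y ↔
      ∃ c : ℝ, c ≠ 0 ∧ complexRoots (S.J y) = complexRoots (c • S.J x) := by
  have him : ∀ c : ℝ, ((complexRoots (S.J x)).map ((c : ℂ) * ·)).map Complex.im =
      (S.imaginaryParts x : Multiset ℝ).map (c * ·) := by
    intro c
    rw [coe_imaginaryParts, Multiset.map_map, Multiset.map_map]
    simp
  rw [eq_comm, type, type, Projectivization.mk_eq_mk_iff']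
  constructor
  · rintro ⟨c, hc⟩
    have hc0 : c ≠ 0 := by
      rintro rfl
      exact S.frequencies_ne_zero y (by rw [← hc, zero_smul])
    refine ⟨c, hc0, ?_⟩
    -- Proportional frequencies give proportional full spectra; the sign of `c` is harmless because
    -- both halves are scaled.
    have h1 : (S.imaginaryParts y : Multiset ℝ) =
        (S.imaginaryParts x : Multiset ℝ).map (c * ·) := by
      rw [coe_imaginaryParts_eq, coe_imaginaryParts_eq, ← hc]
      simp [List.ofFn_eq_map, Function.comp_def]
      exact List.Perm.refl _
    rw [complexRoots_smul _ hc0, complexRoots_eq_map_im (S.re_eq_zero y),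
      complexRoots_eq_map_im (f := S.J x) (S.re_eq_zero x), ← coe_imaginaryParts, h1,
      ← coe_imaginaryParts, Multiset.map_map, Multiset.map_map]
    simp [mul_assoc]
  · rintro ⟨c, hc0, hc⟩
    -- A negative `c` would reverse the order; by symmetry `|c|` scales the spectrum in the same way
    -- and keeps it sorted.
    refine ⟨|c|, ?_⟩
    have h1 := sorted_eq_map_of_symm (S.imaginaryParts_sorted x) (S.imaginaryParts_sorted y)
      (S.imaginaryParts_symm x) (c := c) (by
        rw [coe_imaginaryParts, hc, complexRoots_smul _ hc0, him])
    funext j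
    have h2 := S.length_imaginaryParts x
    have h3 := S.length_imaginaryParts y
    simp only [Pi.smul_apply, smul_eq_mul, frequencies]
    rw [List.getD_eq_getElem _ _ (by omega), List.getD_eq_getElem _ _ (by omega),
      List.getElem_of_eq h1]
    simp

/-- The bracket depends only on the components in `D` and takes values in degree `-2`, so only the
Levi condition remains. -/
lemma isSymmetry_iff (S : CorankOneSubRiemannian E M) {x y : M}
    (γ : S.toCorankOneDistribution.GradedIso x y) :
    S.IsSymmetry γ ↔ (∀ v w, γ.deg2 (S.levi x v w) = S.levi y (γ.deg1 v) (γ.deg1 w)) ∧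
      ∀ v w : S.fiber x, S.metric y (γ.deg1 v) (γ.deg1 w) = S.metric x v w := by
  refine and_congr_left fun _ => ⟨fun h v w => ?_, fun h a b => ?_⟩
  · exact congrArg Prod.snd (h (v, 0) (w, 0))
  · exact Prod.ext (map_zero γ.deg1) (h a.1 b.1)

lemma coform_levi (S : CorankOneSubRiemannian E M) (x : M) (v w : S.fiber x) :
    S.coform x (S.levi x v w) = -S.metric x (S.J x v) w := by
  rw [S.metric_J]
  simp [omega]

/-- Two points are related by a symmetry if and only if they have the same type. -/
theorem exists_isSymmetry_iff (S : CorankOneSubRiemannian E M) (x y : M) :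
    (∃ γ : S.toCorankOneDistribution.GradedIso x y, S.IsSymmetry γ) ↔ S.type x = S.type y := by
  rw [type_eq_iff]
  constructor
  · rintro ⟨γ, hγ⟩
    obtain ⟨hl, hg⟩ := (S.isSymmetry_iff γ).1 hγ
    -- Read through the two coforms, the degree `-2` component is multiplication by the non-zero
    -- number `e 1`.
    set e : ℝ ≃ₗ[ℝ] ℝ := ((S.coform x).symm.trans γ.deg2).trans (S.coform y) with he
    have hc : ∀ q, S.coform y (γ.deg2 q) = e 1 * S.coform x q := by
      intro q
      have h1 : e (S.coform x q) = S.coform y (γ.deg2 q) := by simp [he]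
      rw [← h1, mul_comm, ← smul_eq_mul, ← map_smul, smul_eq_mul, mul_one]
    refine ⟨e 1, by simp, ?_⟩
    have h2 : S.J y = γ.deg1.conj (e 1 • S.J x) := by
      ext1 v
      obtain ⟨v, rfl⟩ := γ.deg1.surjective v
      rw [LinearEquiv.conj_apply_apply, LinearEquiv.symm_apply_apply, ← sub_eq_zero]
      -- The difference of the two endomorphisms at `γ.deg1 v` pairs to zero with every `γ.deg1 w`,
      -- in particular with itself.
      by_contra hne
      refine (S.metric_pos y _ hne).ne' ?_
      obtain ⟨w, hw⟩ := γ.deg1.surjective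
        (S.J y (γ.deg1 v) - γ.deg1 ((e 1 • S.J x) v))
      have h3 := S.coform_levi y (γ.deg1 v) (γ.deg1 w)
      rw [← hl, hc, coform_levi] at h3
      have h4 : S.metric y (S.J y (γ.deg1 v) - γ.deg1 ((e 1 • S.J x) v)) (γ.deg1 w) = 0 := by
        rw [map_sub, LinearMap.sub_apply, hg]
        simp only [LinearMap.smul_apply, map_smul, smul_eq_mul]
        linarith
      rwa [hw] at h4
    rw [h2]
    unfold complexRoots
    rw [LinearEquiv.charpoly_conj]
  · rintro ⟨c, hc0, hc⟩
    obtain ⟨A, hA, hAJ⟩ := exists_isometry_of_charpoly_eq (S.metric x) (S.metric_symm x)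
      (S.metric_pos x) (S.metric y) (S.metric_symm y) (S.metric_pos y) (c • S.J x)
      (fun v w => by simp [S.J_skew x v w]) (S.J y) (S.J_skew y)
      (charpoly_eq_of_complexRoots_eq hc).symm
    -- In degree `-2` the arrow must be multiplication by the same `c` in the coordinates given by
    -- the coforms.
    refine ⟨⟨A, ((S.coform x).trans (LinearEquiv.smulOfNeZero ℝ ℝ c hc0)).trans
      (S.coform y).symm⟩, (S.isSymmetry_iff _).2 ⟨fun v w => ?_, hA⟩⟩
    apply (S.coform y).injective
    rw [coform_levi, ← hAJ, hA]
    simp [coform_levi]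

end CorankOneSubRiemannian

/-! ### Limits of isometries and of scaling factors -/

section MatrixLimits

open Filter

/-- Uniform positivity of quadratic forms near a positive definite one. -/
lemma eventually_quadratic_ge {r : ℕ} (G₀ : Matrix (Fin r) (Fin r) ℝ)
    (hpos : ∀ u : Fin r → ℝ, u ≠ 0 → 0 < u ⬝ᵥ G₀.mulVec u) :
    ∃ m : ℝ, 0 < m ∧ ∀ᶠ B in 𝓝 G₀, ∀ u : Fin r → ℝ, m * ‖u‖ ^ 2 ≤ u ⬝ᵥ B.mulVec u := by
  have hc : Continuous fun p : Matrix (Fin r) (Fin r) ℝ × (Fin r → ℝ) => p.2 ⬝ᵥ p.1.mulVec p.2 :=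
    continuous_snd.dotProduct (continuous_fst.matrix_mulVec continuous_snd)
  obtain ⟨m, hm, hmK⟩ := (isCompact_sphere (0 : Fin r → ℝ) 1).exists_forall_le'
    (f := fun u => u ⬝ᵥ G₀.mulVec u) (hc.comp (Continuous.prodMk_right G₀)).continuousOn (a := 0)
    fun u hu => hpos u (by
      rintro rfl
      simp at hu)
  -- Halving the lower bound on the unit sphere leaves room to perturb the matrix; compactness makes
  -- the perturbation uniform, and homogeneity extends the bound to all vectors.
  refine ⟨m / 2, by positivity, ?_⟩
  have h1 : ∀ᶠ B in 𝓝 G₀, ∀ u ∈ Metric.sphere (0 : Fin r → ℝ) 1, m / 2 < u ⬝ᵥ B.mulVec u := by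
    refine (isCompact_sphere (0 : Fin r → ℝ) 1).eventually_forall_of_forall_eventually
      fun u hu => ?_
    have h2 : m / 2 < u ⬝ᵥ G₀.mulVec u := by linarith [hmK u hu]
    exact (hc.tendsto (G₀, u)).eventually (lt_mem_nhds h2)
  filter_upwards [h1] with B hB u
  rcases eq_or_ne u 0 with rfl | hu
  · simp
  · have hn : 0 < ‖u‖ := norm_pos_iff.2 hu
    have h3 := hB (‖u‖⁻¹ • u) (by simp [norm_smul, hn.ne'])
    rw [Matrix.mulVec_smul, dotProduct_smul, smul_dotProduct, smul_eq_mul, smul_eq_mul] at h3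
    have h4 : u ⬝ᵥ B.mulVec u = ‖u‖ ^ 2 * (‖u‖⁻¹ * (‖u‖⁻¹ * (u ⬝ᵥ B.mulVec u))) := by
      field_simp
    rw [h4, mul_comm]
    exact mul_le_mul_of_nonneg_left h3.le (by positivity)

variable {ι : Type*} (𝒰 : Ultrafilter ι) {r : ℕ} {A G G' L L' : ι → Matrix (Fin r) (Fin r) ℝ}
  {G₀ G₀' L₀ L₀' A₀ : Matrix (Fin r) (Fin r) ℝ} {c : ι → ℝ}

/-- Isometries between converging inner products converge along ultrafilters. -/
lemma exists_tendsto_of_isometry (hG : Tendsto G 𝒰 (𝓝 G₀)) (hG' : Tendsto G' 𝒰 (𝓝 G₀'))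
    (hpos : ∀ u : Fin r → ℝ, u ≠ 0 → 0 < u ⬝ᵥ G₀'.mulVec u)
    (h : ∀ᶠ i in 𝒰, (A i).transpose * G' i * A i = G i) : ∃ A₀, Tendsto A 𝒰 (𝓝 A₀) := by
  obtain ⟨m, hm, hB⟩ := eventually_quadratic_ge G₀' hpos
  have key : ∀ k j, ∃ a, Tendsto (fun i => A i k j) 𝒰 (𝓝 a) := by
    intro k j
    -- The `j`-th column `a` of `A` satisfies `m ‖a‖² ≤ aᵀ G' a = G j j < G₀ j j + 1` eventually, so
    -- its entries lie in a compact interval, where ultrafilters converge.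
    set C : ℝ := (G₀ j j + 1) / m with hC
    have hev : ∀ᶠ i in 𝒰, A i k j ∈ Set.Icc (-√C) √C := by
      have hjj : ∀ᶠ i in 𝒰, G i j j < G₀ j j + 1 :=
        ((tendsto_pi_nhds.1 (tendsto_pi_nhds.1 hG j) j).eventually (gt_mem_nhds (lt_add_one _)))
      filter_upwards [h, hG'.eventually hB, hjj] with i hi hBi hji
      have h1 := hBi ((A i).transpose j)
      have h2 : (A i).transpose j ⬝ᵥ (G' i).mulVec ((A i).transpose j) = G i j j := by
        rw [← hi, Matrix.mul_assoc]
        rfl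
      rw [h2] at h1
      have h3 : ‖(A i).transpose j‖ ^ 2 ≤ C := by
        rw [hC, le_div_iff₀ hm]
        linarith
      have h4 : |A i k j| ≤ ‖(A i).transpose j‖ := norm_le_pi_norm ((A i).transpose j) k
      exact Set.mem_Icc.2 (abs_le.1 (h4.trans (Real.le_sqrt_of_sq_le h3)))
    obtain ⟨a, -, ha⟩ := (isCompact_Icc (a := -√C) (b := √C)).ultrafilter_le_nhds'
      (𝒰.map fun i => A i k j) hev
    exact ⟨a, ha⟩
  choose a ha using key
  exact ⟨Matrix.of a, tendsto_pi_nhds.2 fun k => tendsto_pi_nhds.2 fun j => ha k j⟩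

/-- A kernel vector of `A₀` would be null for the positive form `G₀`. -/
lemma isUnit_of_isometry (hpos : ∀ u : Fin r → ℝ, u ≠ 0 → 0 < u ⬝ᵥ G₀.mulVec u)
    (h : A₀.transpose * G₀' * A₀ = G₀) : IsUnit A₀ := by
  rw [← Matrix.mulVec_injective_iff_isUnit]
  refine (injective_iff_map_eq_zero A₀.mulVecLin).2 fun u hu => ?_
  by_contra hne
  have := hpos u hne
  rw [← h, ← Matrix.mulVec_mulVec] at this
  rw [Matrix.mulVecLin_apply] at hu
  simp [hu] at this

/-- The scalar relating two converging families of forms, conjugate by converging invertible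
matrices, converges to a non-zero number. -/
lemma exists_tendsto_of_smul_eq (hA : Tendsto A 𝒰 (𝓝 A₀)) (hA₀ : IsUnit A₀)
    (hL : Tendsto L 𝒰 (𝓝 L₀)) (hL' : Tendsto L' 𝒰 (𝓝 L₀')) (hL₀ : L₀ ≠ 0) (hL₀' : L₀' ≠ 0)
    (h : ∀ᶠ i in 𝒰, c i • L i = (A i).transpose * L' i * A i) :
    ∃ c₀ : ℝ, c₀ ≠ 0 ∧ Tendsto c 𝒰 (𝓝 c₀) ∧ c₀ • L₀ = A₀.transpose * L₀' * A₀ := by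
  obtain ⟨k, j, hkj⟩ : ∃ k j, L₀ k j ≠ 0 := by
    by_contra! hcon
    exact hL₀ (Matrix.ext hcon)
  have hT : Continuous fun B : Matrix (Fin r) (Fin r) ℝ => B.transpose :=
    continuous_id.matrix_transpose
  have hR : Tendsto (fun i => (A i).transpose * L' i * A i) 𝒰
      (𝓝 (A₀.transpose * L₀' * A₀)) :=
    (((hT.tendsto A₀).comp hA).mul hL').mul hA
  have hLkj := tendsto_pi_nhds.1 (tendsto_pi_nhds.1 hL k) j
  -- At an entry where `L₀` does not vanish, the scalar can be solved for near the limit.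
  have hc : Tendsto c 𝒰 (𝓝 ((A₀.transpose * L₀' * A₀) k j / L₀ k j)) := by
    refine Tendsto.congr' ?_ ((tendsto_pi_nhds.1 (tendsto_pi_nhds.1 hR k) j).div hLkj hkj)
    filter_upwards [h, hLkj.eventually_ne hkj] with i hi hne
    change ((A i).transpose * L' i * A i) k j / L i k j = c i
    rw [← hi]
    simp [hne]
  have hlim : ((A₀.transpose * L₀' * A₀) k j / L₀ k j) • L₀ = A₀.transpose * L₀' * A₀ :=
    tendsto_nhds_unique ((hc.smul hL).congr' h) hR
  -- A zero limit would give `A₀ᵀ L₀' A₀ = 0`, and cancelling the invertible `A₀` would kill `L₀'`.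
  refine ⟨_, fun h0 => hL₀' ?_, hc, hlim⟩
  rw [h0, zero_smul] at hlim
  have hT₀ : IsUnit A₀.transpose := (Matrix.isUnit_transpose A₀).2 hA₀
  rw [eq_comm, hA₀.mul_left_eq_zero, hT₀.mul_right_eq_zero] at hlim
  exact hlim

end MatrixLimits

/-! ### Graded frames and coordinates of arrows -/

variable {E : Type*} [NormedAddCommGroup E] [NormedSpace ℝ E] [FiniteDimensional ℝ E]
  {M : Type*} [TopologicalSpace M] [ChartedSpace E M] [IsManifold 𝓘(ℝ, E) ∞ M]

/-- Linear independence of continuous vector fields is an open condition. -/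
lemma eventually_linearIndependent {r : ℕ} {x : M} (e : Fin r → ∀ y : M, TangentSpace 𝓘(ℝ, E) y)
    (he : ∀ i, ContMDiffAt 𝓘(ℝ, E) 𝓘(ℝ, E).tangent ∞
      (fun y : M => (⟨y, e i y⟩ : TangentBundle 𝓘(ℝ, E) M)) x)
    (hli : LinearIndependent ℝ (fun i => e i x)) :
    ∀ᶠ y in 𝓝 x, LinearIndependent ℝ (fun i => e i y) := by
  set t := trivializationAt E (TangentSpace 𝓘(ℝ, E) : M → Type _) x with ht
  have hxt : x ∈ t.baseSet := FiberBundle.mem_baseSet_trivializationAt' x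
  have hc : ContinuousAt (fun y i => (t ⟨y, e i y⟩).2 : M → Fin r → E) x :=
    continuousAt_pi.2 fun i => ((Bundle.contMDiffAt_section _).1 (he i)).continuousAt
  have hiff : ∀ y ∈ t.baseSet, LinearIndependent ℝ (fun i => (t ⟨y, e i y⟩).2) ↔
      LinearIndependent ℝ (fun i => e i y) := fun y hy =>
    LinearMap.linearIndependent_iff
      (t.continuousLinearEquivAt ℝ y hy).toLinearEquiv.toLinearMap (LinearEquiv.ker _)
  filter_upwards [hc.eventually (((hiff x hxt).2 hli).eventually), t.open_baseSet.mem_nhds hxt]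
    with y hy hyt
  exact (hiff y hyt).1 hy

namespace CorankOneDistribution

lemma span_range_coe (D : CorankOneDistribution E M) (x : M)
    (e : Fin (Module.finrank ℝ E - 1) → D.fiber x) (he : LinearIndependent ℝ e) :
    Submodule.span ℝ (Set.range fun i => (e i : TangentSpace 𝓘(ℝ, E) x)) = D.fiber x := by
  have h1 : Submodule.span ℝ (Set.range e) = ⊤ :=
    he.span_eq_top_of_card_eq_finrank' (by rw [Fintype.card_fin, D.finrank_fiber])
  have h2 := congrArg (Submodule.map (D.fiber x).subtype) h1
  rw [Submodule.map_span, ← Set.range_comp, Submodule.map_top, Submodule.range_subtype] at h2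
  exact h2

/-- Turns the two pointwise conditions on a graded frame into independence of a frame of `TM`, which
is an open condition. -/
lemma linearIndependent_cons_iff (D : CorankOneDistribution E M) (x : M)
    (e : Fin (Module.finrank ℝ E - 1) → D.fiber x) (v : TangentSpace 𝓘(ℝ, E) x) :
    LinearIndependent ℝ (Fin.cons v fun i => (e i : TangentSpace 𝓘(ℝ, E) x) :
      Fin (Module.finrank ℝ E - 1 + 1) → TangentSpace 𝓘(ℝ, E) x) ↔
      LinearIndependent ℝ e ∧ v ∉ D.fiber x := by
  rw [linearIndependent_finCons]
  have h1 : LinearIndependent ℝ (fun i => (e i : TangentSpace 𝓘(ℝ, E) x)) ↔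
      LinearIndependent ℝ e :=
    LinearMap.linearIndependent_iff (D.fiber x).subtype (Submodule.ker_subtype _)
  rw [h1]
  exact and_congr_right fun h => by rw [D.span_range_coe x e h]

lemma exists_gradedFrame (D : CorankOneDistribution E M) (x : M) :
    ∃ F : D.GradedFrame, x ∈ F.dom := by
  obtain ⟨U, hU, hxU, he, hli⟩ := D.frame_spec x
  set t := trivializationAt E (TangentSpace 𝓘(ℝ, E) : M → Type _) x with ht
  have hxt : x ∈ t.baseSet := FiberBundle.mem_baseSet_trivializationAt' x
  let b := Module.finBasis ℝ E
  -- Some vector of a local frame of `TM` is transverse at `x` because `D_x` is a proper subspace;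
  -- it stays transverse nearby by openness.
  obtain ⟨i, hi⟩ : ∃ i, t.localFrame b i x ∉ D.fiber x := by
    by_contra! hcon
    have h1 : (⊤ : Submodule ℝ (TangentSpace 𝓘(ℝ, E) x)) ≤ D.fiber x := by
      rw [← (t.basisAt b hxt).span_eq, Submodule.span_le]
      rintro _ ⟨i, rfl⟩
      rw [← t.localFrame_apply_of_mem_baseSet b hxt]
      exact hcon i
    have h2 := D.corank_one x
    rw [top_le_iff.1 h1, finrank_top] at h2
    have h3 : Module.finrank ℝ (TangentSpace 𝓘(ℝ, E) x) = Module.finrank ℝ E := rfl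
    omega
  have hf : ContMDiffOn 𝓘(ℝ, E) 𝓘(ℝ, E).tangent ∞
      (fun y : M => (⟨y, t.localFrame b i y⟩ : TangentBundle 𝓘(ℝ, E) M)) t.baseSet :=
    t.contMDiffOn_localFrame_baseSet ∞ b i
  have hev := eventually_linearIndependent (x := x)
    (fun k y => (Fin.cons (t.localFrame b i y)
      fun j => (D.frame x j y : TangentSpace 𝓘(ℝ, E) y) :
        Fin (Module.finrank ℝ E - 1 + 1) → TangentSpace 𝓘(ℝ, E) y) k)
    (fun k => by
      refine Fin.cases ?_ (fun j => ?_) k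
      · exact hf.contMDiffAt (t.open_baseSet.mem_nhds hxt)
      · exact (he j).contMDiffAt (hU.mem_nhds hxU))
    ((D.linearIndependent_cons_iff x _ _).2 ⟨hli x hxU, hi⟩)
  obtain ⟨O, hO, hOo, hxO⟩ := eventually_nhds_iff.1 hev
  exact ⟨{
    dom := U ∩ t.baseSet ∩ O
    isOpen_dom := (hU.inter t.open_baseSet).inter hOo
    e := D.frame x
    f := t.localFrame b i
    smooth_e := fun j => (he j).mono fun y hy => hy.1.1
    smooth_f := hf.mono fun y hy => hy.1.2
    linearIndependent := fun y hy => hli y hy.1.1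
    notMem := fun y hy => ((D.linearIndependent_cons_iff y _ _).1 (hO y hy.2)).2 },
    ⟨⟨hxU, hxt⟩, hxO⟩⟩

namespace GradedFrame

variable {D : CorankOneDistribution E M}

lemma equiv1_e (F : D.GradedFrame) (x : F.dom) (i : Fin (Module.finrank ℝ E - 1)) :
    F.equiv1 x (F.e i x) = Pi.single i 1 := by
  have h : F.e i x = D.basisOf x _ (F.linearIndependent x x.2) i := by simp [basisOf]
  ext j
  rw [h, equiv1, Module.Basis.equivFun_self]
  simp [Pi.single_apply, eq_comm]

lemma equiv1_symm (F : D.GradedFrame) (x : F.dom) (u : Fin (Module.finrank ℝ E - 1) → ℝ) :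
    (F.equiv1 x).symm u = ∑ i, u i • F.e i x := by
  simp [equiv1, Module.Basis.equivFun_symm_apply, basisOf]

lemma equiv2_apply (F : D.GradedFrame) (x : F.dom) (c : ℝ) :
    F.equiv2 x c = c • (D.fiber x).mkQ (F.f x) := rfl

/-- The matrix of the Levi map in a graded frame. -/
def leviMatrix (F : D.GradedFrame) (x : F.dom) :
    Matrix (Fin (Module.finrank ℝ E - 1)) (Fin (Module.finrank ℝ E - 1)) ℝ :=
  Matrix.of fun i j => (F.equiv2 x).symm (D.levi x (F.e i x) (F.e j x))

lemma contMDiffAt_e (F : D.GradedFrame) (x : F.dom) (i : Fin (Module.finrank ℝ E - 1)) :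
    ContMDiffAt 𝓘(ℝ, E) 𝓘(ℝ, E).tangent ∞ (fun y : M =>
      (⟨y, (F.e i y : TangentSpace 𝓘(ℝ, E) y)⟩ : TangentBundle 𝓘(ℝ, E) M)) x :=
  (F.smooth_e i).contMDiffAt (F.isOpen_dom.mem_nhds x.2)

/-- Expand the smooth bracket of two frame fields in the frame formed by `F.f` and `F.e`. Modulo `D`
only the coefficient of `F.f` survives, and coefficients in a frame are continuous. -/
lemma continuous_leviMatrix (F : D.GradedFrame) : Continuous F.leviMatrix := by
  have : CompleteSpace E := FiniteDimensional.complete ℝ E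
  refine continuous_pi fun i => continuous_pi fun j => continuous_iff_continuousAt.2 fun x => ?_
  let b : Fin (Module.finrank ℝ E - 1 + 1) → ∀ y : M, TangentSpace 𝓘(ℝ, E) y := fun k y =>
    (Fin.cons (F.f y) fun j => (F.e j y : TangentSpace 𝓘(ℝ, E) y) :
      Fin (Module.finrank ℝ E - 1 + 1) → TangentSpace 𝓘(ℝ, E) y) k
  have hb : ∀ k, MDifferentiableAt 𝓘(ℝ, E) 𝓘(ℝ, E).tangent
      (fun y : M => (⟨y, b k y⟩ : TangentBundle 𝓘(ℝ, E) M)) (x : M) := by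
    intro k
    refine Fin.cases ?_ (fun j => ?_) k
    · exact (F.smooth_f.contMDiffAt (F.isOpen_dom.mem_nhds x.2)).mdifferentiableAt (by simp)
    · exact (F.contMDiffAt_e x j).mdifferentiableAt (by simp)
  have hbli : ∀ y ∈ F.dom, LinearIndependent ℝ (fun k => b k y) := fun y hy =>
    (D.linearIndependent_cons_iff y _ _).2 ⟨F.linearIndependent y hy, F.notMem y hy⟩
  have hX : MDifferentiableAt 𝓘(ℝ, E) 𝓘(ℝ, E).tangent (fun y : M =>
      (⟨y, bracketAt D.fiber (F.e i) (F.e j) y⟩ : TangentBundle 𝓘(ℝ, E) M)) (x : M) := by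
    have : IsManifold 𝓘(ℝ, E) ((⊤ : ℕ∞) + 1) M := inferInstanceAs (IsManifold 𝓘(ℝ, E) ∞ M)
    have : IsManifold 𝓘(ℝ, E) (minSmoothness ℝ 2) M := by
      rw [minSmoothness_of_isRCLikeNormedField]
      infer_instance
    have h1 := ContMDiffAt.mlieBracket_vectorField (m := 1) (n := ⊤) (F.contMDiffAt_e x i)
      (F.contMDiffAt_e x j) (by
        rw [minSmoothness_of_isRCLikeNormedField]
        exact_mod_cast le_top)
    exact h1.mdifferentiableAt (by simp)
  obtain ⟨c, hc, hcX⟩ := exists_coeff b hb (hbli x x.2)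
    (fun y => bracketAt D.fiber (F.e i) (F.e j) y) hX (by
      filter_upwards [F.isOpen_dom.mem_nhds x.2] with y hy
      have : FiniteDimensional ℝ (TangentSpace 𝓘(ℝ, E) y) :=
        inferInstanceAs (FiniteDimensional ℝ E)
      have h2 : Submodule.span ℝ (Set.range fun k => b k y) = ⊤ :=
        (hbli y hy).span_eq_top_of_card_eq_finrank' (by
          rw [Fintype.card_fin, Nat.sub_add_cancel (by have := D.corank_one y; omega)]
          rfl)
      rw [h2]
      trivial)
  have h3 : ContinuousAt (fun y : F.dom => c 0 y) x :=
    (hc 0).continuousAt.comp continuous_subtype_val.continuousAt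
  refine h3.congr ?_
  filter_upwards [continuous_subtype_val.continuousAt.eventually hcX] with y hy
  change c 0 y = (F.equiv2 y).symm (D.levi y (F.e i y) (F.e j y))
  rw [LinearEquiv.eq_symm_apply, equiv2_apply,
    D.levi_apply y (F.e i) (F.e j) ((F.contMDiffAt_e y i).mdifferentiableAt (by simp))
      ((F.contMDiffAt_e y j).mdifferentiableAt (by simp)), hy, Fin.sum_univ_succ, map_add, map_sum,
    Finset.sum_eq_zero fun k _ => ?_, add_zero, map_smul]
  · rfl
  · rw [map_smul]
    refine smul_eq_zero_of_right _ ?_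
    exact (Submodule.Quotient.mk_eq_zero _).2 (F.e k y).2

lemma deg1_arrow (F F' : D.GradedFrame)
    (p : F.dom × F'.dom × GL (Fin (Module.finrank ℝ E - 1)) ℝ × ℝˣ)
    (j : Fin (Module.finrank ℝ E - 1)) :
    (arrow F F' p).iso.deg1 (F.e j p.1) = ∑ i, (p.2.2.1 : Matrix _ _ ℝ) i j • F'.e i p.2.1 := by
  change (F'.equiv1 p.2.1).symm (Matrix.toLin' (p.2.2.1 : Matrix _ _ ℝ)
    (F.equiv1 p.1 (F.e j p.1))) = _
  rw [equiv1_e, equiv1_symm, Matrix.toLin'_apply, Matrix.mulVec_single_one]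
  rfl

lemma deg2_arrow (F F' : D.GradedFrame)
    (p : F.dom × F'.dom × GL (Fin (Module.finrank ℝ E - 1)) ℝ × ℝˣ) (a : ℝ) :
    (arrow F F' p).iso.deg2 (F.equiv2 p.1 a) = F'.equiv2 p.2.1 (p.2.2.2 * a) := by
  change F'.equiv2 p.2.1 (p.2.2.2 • (F.equiv2 p.1).symm (F.equiv2 p.1 a)) = _
  rw [LinearEquiv.symm_apply_apply]
  rfl

/-- The coordinates are the matrix of `deg1` and the number `u 1`: a linear automorphism of `ℝ` is
multiplication by its value at `1`. -/
lemma exists_arrow_eq (F F' : D.GradedFrame) (γ : D.GLgr) (h : γ.src ∈ F.dom)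
    (h' : γ.tgt ∈ F'.dom) : ∃ p, arrow F F' p = γ := by
  obtain ⟨x, y, γ⟩ := γ
  let u : ℝ ≃ₗ[ℝ] ℝ := ((F.equiv2 ⟨x, h⟩).trans γ.deg2).trans (F'.equiv2 ⟨y, h'⟩).symm
  have hu : u 1 ≠ 0 := by simp
  refine ⟨(⟨x, h⟩, ⟨y, h'⟩, Matrix.GeneralLinearGroup.toLin.symm
    (LinearMap.GeneralLinearGroup.ofLinearEquiv
      (((F.equiv1 ⟨x, h⟩).symm.trans γ.deg1).trans (F'.equiv1 ⟨y, h'⟩))), Units.mk0 _ hu), ?_⟩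
  unfold arrow
  congr 1
  refine GradedIso.ext ?_ ?_
  · ext v
    simp
  · ext v
    obtain ⟨a, rfl⟩ := (F.equiv2 ⟨x, h⟩).surjective v
    change F'.equiv2 ⟨y, h'⟩ (u 1 * (F.equiv2 ⟨x, h⟩).symm (F.equiv2 ⟨x, h⟩ a)) = _
    rw [LinearEquiv.symm_apply_apply, mul_comm, ← smul_eq_mul, ← map_smul, smul_eq_mul, mul_one]
    simp [u]

end GradedFrame

end CorankOneDistribution

/-! ### Topology of the space of arrows -/

/-- Convergence of invertible matrices is convergence of their entries. -/
lemma tendsto_generalLinearGroup {ι : Type*} {l : Filter ι} {r : ℕ} {A : ι → GL (Fin r) ℝ}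
    {A₀ : GL (Fin r) ℝ} (h : Filter.Tendsto (fun i => (A i : Matrix (Fin r) (Fin r) ℝ)) l
      (𝓝 (A₀ : Matrix (Fin r) (Fin r) ℝ))) : Filter.Tendsto A l (𝓝 A₀) := by
  -- The topology on units also demands convergence of the inverses, which follows from the adjugate
  -- formula since the limit determinant is non-zero.
  rw [Units.isInducing_embedProduct.tendsto_nhds_iff]
  refine h.prodMk_nhds ((MulOpposite.continuous_op.tendsto _).comp ?_)
  have hdet : Continuous fun B : Matrix (Fin r) (Fin r) ℝ => B.det := continuous_id.matrix_det
  have hadj : Continuous fun B : Matrix (Fin r) (Fin r) ℝ => B.adjugate :=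
    continuous_id.matrix_adjugate
  have hinv : ∀ B : GL (Fin r) ℝ, ((B⁻¹ : GL (Fin r) ℝ) : Matrix (Fin r) (Fin r) ℝ) =
      ((B : Matrix (Fin r) (Fin r) ℝ).det)⁻¹ • (B : Matrix (Fin r) (Fin r) ℝ).adjugate := by
    intro B
    rw [Matrix.coe_units_inv, Matrix.inv_def, Ring.inverse_eq_inv']
  have hne : (A₀ : Matrix (Fin r) (Fin r) ℝ).det ≠ 0 :=
    ((Matrix.isUnit_iff_isUnit_det _).1 A₀.isUnit).ne_zero
  have h1 := (((hdet.tendsto _).comp h).inv₀ hne).smul ((hadj.tendsto _).comp h)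
  rw [← hinv] at h1
  exact h1.congr fun i => (hinv (A i)).symm

lemma transpose_mul_mul_apply {r : ℕ} (A N : Matrix (Fin r) (Fin r) ℝ) (i j : Fin r) :
    (A.transpose * N * A) i j = ∑ k, ∑ l, A k i * (A l j * N k l) := by
  simp only [Matrix.mul_apply, Matrix.transpose_apply, Finset.sum_mul]
  rw [Finset.sum_comm]
  exact Finset.sum_congr rfl fun k _ => Finset.sum_congr rfl fun l _ => by ring

namespace CorankOneDistribution

lemma continuous_arrow {D : CorankOneDistribution E M} (F F' : D.GradedFrame) :
    Continuous (GradedFrame.arrow F F') :=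
  continuous_iff_coinduced_le.2 (le_iSup₂_of_le F F' le_rfl)

/-- The topology on arrows is final for the charts, and in a chart source and target are
projections. -/
lemma continuous_src_tgt (D : CorankOneDistribution E M) :
    Continuous fun γ : D.GLgr => (γ.src, γ.tgt) := by
  refine continuous_iSup_dom.2 fun F => continuous_iSup_dom.2 fun F' =>
    continuous_coinduced_dom.2 ?_
  exact (continuous_subtype_val.comp continuous_fst).prodMk
    (continuous_subtype_val.comp (continuous_fst.comp continuous_snd))

end CorankOneDistribution

/-! ### Properness and image of the anchor -/

namespace CorankOneSubRiemannian

open CorankOneDistribution Filter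

/-- The Gram matrix of a graded frame. -/
def gramMatrix (S : CorankOneSubRiemannian E M) (F : S.toCorankOneDistribution.GradedFrame)
    (x : F.dom) : Matrix (Fin (Module.finrank ℝ E - 1)) (Fin (Module.finrank ℝ E - 1)) ℝ :=
  Matrix.of fun i j => S.metric x (F.e i x) (F.e j x)

lemma continuous_gramMatrix (S : CorankOneSubRiemannian E M)
    (F : S.toCorankOneDistribution.GradedFrame) : Continuous (S.gramMatrix F) :=
  continuous_pi fun i => continuous_pi fun j => continuousOn_iff_continuous_domRestrict.1
    (S.metric_smooth F.dom F.isOpen_dom (F.e i) (F.e j) (F.smooth_e i) (F.smooth_e j)).continuousOn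

lemma gramMatrix_pos (S : CorankOneSubRiemannian E M)
    (F : S.toCorankOneDistribution.GradedFrame) (x : F.dom)
    (u : Fin (Module.finrank ℝ E - 1) → ℝ) (hu : u ≠ 0) :
    0 < u ⬝ᵥ (S.gramMatrix F x).mulVec u := by
  have h1 : (F.equiv1 x).symm u ≠ 0 := by simpa using hu
  have h2 := S.metric_pos x _ h1
  rw [F.equiv1_symm] at h2
  simp only [map_sum, map_smul, LinearMap.sum_apply, LinearMap.smul_apply, smul_eq_mul] at h2
  refine h2.trans_eq ?_
  simp only [dotProduct, Matrix.mulVec, gramMatrix, Matrix.of_apply, Finset.mul_sum]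
  rw [Finset.sum_comm]
  exact Finset.sum_congr rfl fun i _ => Finset.sum_congr rfl fun j _ => by ring

lemma bilin_ext_frame {S : CorankOneSubRiemannian E M} {N : Type*} [AddCommGroup N] [Module ℝ N]
    (F : S.toCorankOneDistribution.GradedFrame) (x : F.dom)
    {B B' : S.fiber x →ₗ[ℝ] S.fiber x →ₗ[ℝ] N}
    (h : ∀ i j, B (F.e i x) (F.e j x) = B' (F.e i x) (F.e j x)) : B = B' := by
  let b := S.basisOf x _ (F.linearIndependent x x.2)
  have hb : ∀ i, b i = F.e i x := fun i => by simp [b, basisOf]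
  exact b.ext fun i => b.ext fun j => by simp only [hb, h]

/-- Non-integrability enters the limit argument here: it controls the degree `-2` scalar, which the
metric does not see. -/
lemma leviMatrix_ne_zero (S : CorankOneSubRiemannian E M)
    (F : S.toCorankOneDistribution.GradedFrame) (x : F.dom) : F.leviMatrix x ≠ 0 := by
  intro h0
  obtain ⟨v, w, hvw⟩ := S.exists_levi_ne_zero x
  refine hvw ?_
  have h1 : S.levi x = 0 := bilin_ext_frame F x fun i j => by
    have := congrFun (congrFun h0 i) j
    simpa [GradedFrame.leviMatrix] using this
  simp [h1]

/-- Symmetries in terms of matrices with respect to graded frames. -/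
lemma isSymmetry_arrow_iff (S : CorankOneSubRiemannian E M)
    (F F' : S.toCorankOneDistribution.GradedFrame)
    (p : F.dom × F'.dom × GL (Fin (Module.finrank ℝ E - 1)) ℝ × ℝˣ) :
    S.IsSymmetry (GradedFrame.arrow F F' p).iso ↔
      (p.2.2.2 : ℝ) • F.leviMatrix p.1 =
        (p.2.2.1 : Matrix _ _ ℝ).transpose * F'.leviMatrix p.2.1 * (p.2.2.1 : Matrix _ _ ℝ) ∧
      (p.2.2.1 : Matrix _ _ ℝ).transpose * S.gramMatrix F' p.2.1 * (p.2.2.1 : Matrix _ _ ℝ) =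
        S.gramMatrix F p.1 := by
  rw [isSymmetry_iff]
  refine and_congr ?_ ?_
  · have h1 : (∀ v w, (GradedFrame.arrow F F' p).iso.deg2 (S.levi p.1 v w) =
        S.levi p.2.1 ((GradedFrame.arrow F F' p).iso.deg1 v)
          ((GradedFrame.arrow F F' p).iso.deg1 w)) ↔
        ∀ i j, (GradedFrame.arrow F F' p).iso.deg2 (S.levi p.1 (F.e i p.1) (F.e j p.1)) =
        S.levi p.2.1 ((GradedFrame.arrow F F' p).iso.deg1 (F.e i p.1))
          ((GradedFrame.arrow F F' p).iso.deg1 (F.e j p.1)) := by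
      refine ⟨fun h i j => h _ _, fun h v w => ?_⟩
      have := bilin_ext_frame F p.1
        (B := (S.levi p.1).compr₂ (GradedFrame.arrow F F' p).iso.deg2.toLinearMap)
        (B' := (S.levi p.2.1).compl₁₂ (GradedFrame.arrow F F' p).iso.deg1.toLinearMap
          (GradedFrame.arrow F F' p).iso.deg1.toLinearMap) h
      exact congrArg (fun B => B v w) this
    refine h1.trans (Iff.trans ?_ Matrix.ext_iff)
    refine forall_congr' fun i => forall_congr' fun j => ?_
    have h2 : S.levi p.1 (F.e i p.1) (F.e j p.1) = F.equiv2 p.1 (F.leviMatrix p.1 i j) := by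
      simp [GradedFrame.leviMatrix]
    have h3 : ∀ k l, S.levi p.2.1 (F'.e k p.2.1) (F'.e l p.2.1) =
        F'.equiv2 p.2.1 (F'.leviMatrix p.2.1 k l) := fun k l => by
      simp [GradedFrame.leviMatrix]
    rw [h2, GradedFrame.deg2_arrow, GradedFrame.deg1_arrow, GradedFrame.deg1_arrow,
      transpose_mul_mul_apply]
    simp only [map_sum, map_smul, LinearMap.sum_apply, LinearMap.smul_apply, h3]
    simp only [← map_smul, ← map_sum, smul_eq_mul]
    refine (F'.equiv2 p.2.1).injective.eq_iff.trans ?_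
    rw [Matrix.smul_apply, smul_eq_mul, Finset.sum_comm]
    simp only [Finset.mul_sum, mul_left_comm]
  · have h1 : (∀ v w, S.metric p.2.1 ((GradedFrame.arrow F F' p).iso.deg1 v)
          ((GradedFrame.arrow F F' p).iso.deg1 w) = S.metric p.1 v w) ↔
        ∀ i j, S.metric p.2.1 ((GradedFrame.arrow F F' p).iso.deg1 (F.e i p.1))
          ((GradedFrame.arrow F F' p).iso.deg1 (F.e j p.1)) =
          S.metric p.1 (F.e i p.1) (F.e j p.1) := by
      refine ⟨fun h i j => h _ _, fun h v w => ?_⟩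
      have := bilin_ext_frame F p.1
        (B := (S.metric p.2.1).compl₁₂ (GradedFrame.arrow F F' p).iso.deg1.toLinearMap
          (GradedFrame.arrow F F' p).iso.deg1.toLinearMap) (B' := S.metric p.1) h
      exact congrArg (fun B => B v w) this
    refine h1.trans (Iff.trans ?_ Matrix.ext_iff)
    refine forall_congr' fun i => forall_congr' fun j => ?_
    rw [GradedFrame.deg1_arrow, GradedFrame.deg1_arrow, transpose_mul_mul_apply]
    simp only [map_sum, map_smul, LinearMap.sum_apply, LinearMap.smul_apply, smul_eq_mul,
      gramMatrix, Matrix.of_apply, Finset.mul_sum]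
    rw [Finset.sum_comm]
    simp only [mul_left_comm]

lemma continuous_anchor (S : CorankOneSubRiemannian E M) : Continuous S.anchor :=
  S.continuous_src_tgt.comp continuous_subtype_val

/-- Coordinates of symmetries, whose sources and targets converge, converge along ultrafilters. -/
lemma exists_tendsto_coordinates (S : CorankOneSubRiemannian E M)
    (F F' : S.toCorankOneDistribution.GradedFrame) {ι : Type*} (𝒰 : Ultrafilter ι)
    (p : ι → F.dom × F'.dom × GL (Fin (Module.finrank ℝ E - 1)) ℝ × ℝˣ) {x₀ : F.dom} {y₀ : F'.dom}
    (hx : Tendsto (fun i => (p i).1) 𝒰 (𝓝 x₀)) (hy : Tendsto (fun i => (p i).2.1) 𝒰 (𝓝 y₀))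
    (hsym : ∀ᶠ i in 𝒰, S.IsSymmetry (GradedFrame.arrow F F' (p i)).iso) :
    ∃ q : GL (Fin (Module.finrank ℝ E - 1)) ℝ × ℝˣ,
      S.IsSymmetry (GradedFrame.arrow F F' (x₀, y₀, q)).iso ∧
      Tendsto p 𝒰 (𝓝 (x₀, y₀, q)) := by
  have hsym' := hsym.mono fun i hi => (S.isSymmetry_arrow_iff F F' (p i)).1 hi
  have hG : Tendsto (fun i => S.gramMatrix F (p i).1) 𝒰 (𝓝 (S.gramMatrix F x₀)) :=
    ((S.continuous_gramMatrix F).tendsto _).comp hx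
  have hG' : Tendsto (fun i => S.gramMatrix F' (p i).2.1) 𝒰 (𝓝 (S.gramMatrix F' y₀)) :=
    ((S.continuous_gramMatrix F').tendsto _).comp hy
  have hL : Tendsto (fun i => F.leviMatrix (p i).1) 𝒰 (𝓝 (F.leviMatrix x₀)) :=
    (F.continuous_leviMatrix.tendsto _).comp hx
  have hL' : Tendsto (fun i => F'.leviMatrix (p i).2.1) 𝒰 (𝓝 (F'.leviMatrix y₀)) :=
    (F'.continuous_leviMatrix.tendsto _).comp hy
  have hiso := hsym'.mono fun i hi => hi.2
  have hlev := hsym'.mono fun i hi => hi.1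
  obtain ⟨A₀, hA⟩ := exists_tendsto_of_isometry 𝒰 hG hG' (S.gramMatrix_pos F' _) hiso
  have hT : Continuous fun B : Matrix (Fin (Module.finrank ℝ E - 1))
      (Fin (Module.finrank ℝ E - 1)) ℝ => B.transpose := continuous_id.matrix_transpose
  -- The isometry equation passes to the limit by uniqueness of limits of matrices.
  have hA₀G : A₀.transpose * S.gramMatrix F' y₀ * A₀ = S.gramMatrix F x₀ :=
    tendsto_nhds_unique (((((hT.tendsto A₀).comp hA).mul hG').mul hA).congr' hiso) hG
  obtain ⟨A₁, rfl⟩ := isUnit_of_isometry (S.gramMatrix_pos F _) hA₀G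
  obtain ⟨c₀, hc₀, hc, hcL⟩ := exists_tendsto_of_smul_eq 𝒰 hA A₁.isUnit hL hL'
    (S.leviMatrix_ne_zero F _) (S.leviMatrix_ne_zero F' _) hlev
  refine ⟨(A₁, Units.mk0 c₀ hc₀), (S.isSymmetry_arrow_iff F F' _).2 ⟨hcL, hA₀G⟩, ?_⟩
  have hc' : Tendsto (fun i => (p i).2.2.2) 𝒰 (𝓝 (Units.mk0 c₀ hc₀)) :=
    Units.isEmbedding_val₀.tendsto_nhds_iff.2 hc
  exact hx.prodMk_nhds (hy.prodMk_nhds ((tendsto_generalLinearGroup hA).prodMk_nhds hc'))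

theorem isProperMap_anchor (S : CorankOneSubRiemannian E M) : IsProperMap S.anchor := by
  refine isProperMap_iff_ultrafilter.2 ⟨S.continuous_anchor, fun 𝒰 ⟨x₀, y₀⟩ h𝒰 => ?_⟩
  obtain ⟨F, hF⟩ := S.exists_gradedFrame x₀
  obtain ⟨F', hF'⟩ := S.exists_gradedFrame y₀
  have hsrc : Tendsto (fun γ : S.SymmetryGroupoid => γ.1.src) 𝒰 (𝓝 x₀) :=
    (continuous_fst.tendsto _).comp h𝒰
  have htgt : Tendsto (fun γ : S.SymmetryGroupoid => γ.1.tgt) 𝒰 (𝓝 y₀) :=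
    (continuous_snd.tendsto _).comp h𝒰
  have hex : ∀ γ : S.SymmetryGroupoid,
      ∃ p : F.dom × F'.dom × GL (Fin (Module.finrank ℝ E - 1)) ℝ × ℝˣ,
        γ.1.src ∈ F.dom → γ.1.tgt ∈ F'.dom → GradedFrame.arrow F F' p = γ.1 := by
    intro γ
    by_cases h : γ.1.src ∈ F.dom ∧ γ.1.tgt ∈ F'.dom
    · obtain ⟨p, hp⟩ := GradedFrame.exists_arrow_eq F F' γ.1 h.1 h.2
      exact ⟨p, fun _ _ => hp⟩
    -- A dummy value for arrows outside the frame domains; the ultrafilter eventually avoids them.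
    · exact ⟨(⟨x₀, hF⟩, ⟨y₀, hF'⟩, 1, 1), fun h1 h2 => absurd ⟨h1, h2⟩ h⟩
  choose p hp using hex
  have hev : ∀ᶠ γ in 𝒰, GradedFrame.arrow F F' (p γ) = γ.1 := by
    filter_upwards [hsrc.eventually (F.isOpen_dom.mem_nhds hF),
      htgt.eventually (F'.isOpen_dom.mem_nhds hF')] with γ h h' using hp γ h h'
  have hsym : ∀ᶠ γ in 𝒰, S.IsSymmetry (GradedFrame.arrow F F' (p γ)).iso := by
    filter_upwards [hev] with γ hγ
    rw [hγ]
    exact γ.2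
  have hx : Tendsto (fun γ => (p γ).1) 𝒰 (𝓝 (⟨x₀, hF⟩ : F.dom)) :=
    tendsto_subtype_rng.2 (hsrc.congr' (hev.mono fun γ hγ => congrArg GLgr.src hγ.symm))
  have hy : Tendsto (fun γ => (p γ).2.1) 𝒰 (𝓝 (⟨y₀, hF'⟩ : F'.dom)) :=
    tendsto_subtype_rng.2 (htgt.congr' (hev.mono fun γ hγ => congrArg GLgr.tgt hγ.symm))
  obtain ⟨q, hq, hlim⟩ := S.exists_tendsto_coordinates F F' 𝒰 p hx hy hsym
  refine ⟨⟨GradedFrame.arrow F F' (⟨x₀, hF⟩, ⟨y₀, hF'⟩, q), hq⟩, rfl, ?_⟩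
  -- Only continuity of the chart map is needed to carry the limit of coordinates to a limit of
  -- arrows.
  have h1 : Tendsto (fun γ : S.SymmetryGroupoid => γ.1) 𝒰
      (𝓝 (GradedFrame.arrow F F' (⟨x₀, hF⟩, ⟨y₀, hF'⟩, q))) :=
    (((continuous_arrow F F').tendsto _).comp hlim).congr' hev
  exact tendsto_subtype_rng.2 h1

lemma range_anchor (S : CorankOneSubRiemannian E M) :
    Set.range S.anchor = {p : M × M | S.type p.1 = S.type p.2} := by
  ext ⟨x, y⟩
  rw [Set.mem_ofPred_eq, ← S.exists_isSymmetry_iff]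
  constructor
  · rintro ⟨⟨⟨x', y', γ⟩, hγ⟩, h⟩
    obtain ⟨rfl, rfl⟩ := Prod.ext_iff.1 h
    exact ⟨γ, hγ⟩
  · rintro ⟨γ, hγ⟩
    exact ⟨⟨⟨x, y, γ⟩, hγ⟩, rfl⟩

end CorankOneSubRiemannian

end SubRiemannian

end

theorem proposition3p3 {E : Type*} [NormedAddCommGroup E] [NormedSpace ℝ E]
    [FiniteDimensional ℝ E] {M : Type*} [TopologicalSpace M] [T2Space M]
    [SecondCountableTopology M] [ChartedSpace E M] [IsManifold 𝓘(ℝ, E) ∞ M]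
    (S : SubRiemannian.CorankOneSubRiemannian E M) :
    IsProperMap S.anchor ∧
      (∀ x : M, IsCompact {γ : S.SymmetryGroupoid | S.anchor γ = (x, x)}) ∧
      Set.range S.anchor = {p : M × M | S.type p.1 = S.type p.2} ∧
      IsClosed {p : M × M | S.type p.1 = S.type p.2} := by
  have h := S.isProperMap_anchor
  refine ⟨h, fun x => h.isCompact_preimage isCompact_singleton, S.range_anchor, ?_⟩
  -- Closedness is read off from the closed image of a proper map, without proving continuity of the
  -- type map.
  rw [← S.range_anchor]
  exact h.isClosedMap.isClosed_range
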